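/- Let $p$ be a prime, $n\ge 1$ an integer, and let $F=GF(p^n)$ be the field with $p^n$ elements. For a ring $R$ with $1$, let $\Lambda^1(R)$ be the undirected graph (loops allowed) whose vertices are the equivalence classes $[a]_1$ of elements $a\in R$ under the relation "$a$ and $b$ individually generate the same unital subring of $R$", with $[a]_1$ and $[b]_1$ adjacent if and only if $ab=ba$. Write $d(n)$ and $\sigma(n)$ for the number and the sum of the positive divisors of $n$, $K_m^\circ$ for the complete graph on $m$ vertices with all loops, $\cup$ for disjoint union, $tG$ for the disjoint union of $t$ copies of $G$, and $G\vee H$ for the join (the disjoint union together with all edges between $G$ and $H$). Put $$a(n)=\begin{cases} d(n)^2-d(n)+\sigma(n)-1 & \text{if } p=2 \text{ and } n \text{ is even},\\ d(n)^2-d(n)+\sigma(n) & \text{if } p>2 \text{ or } n \text{ is odd},\end{cases}\qquad b(n)=\sum_{d\mid n}\frac{p^n-1}{p^d-1},\qquad c(n)=d(2n)-d(n).$$ Then $$\Lambda^1(\mathcal M_2(F))\;\cong\; K_{d(n)}^\circ\vee\left(\tfrac{p^{2n}+p^n}{2}K_{a(n)}^\circ\,\cup\,(p^n+1)K_{b(n)}^\circ\,\cup\,\tfrac{p^{2n}-p^n}{2}K_{c(n)}^\circ\right).$$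 Moreover, the isomorphism can be chosen so that the class of $A\in\mathcal M_2(F)$ lies in $K_{d(n)}^\circ$ if and only if $A$ is central, in the first family of cliques if and only if the minimal polynomial of $A$ over $F$ has two distinct roots in $F$, in the second family if and only if the minimal polynomial of $A$ is $(x-\lambda)^2$ for some $\lambda\in F$, and in the third family if and only if $A$ is non-central and its minimal polynomial is irreducible over $F$. The classes of two non-central matrices are adjacent if and only if the two matrices have the same centralizer. The numbers of distinct centralizers of matrices of these three types are $\frac{p^{2n}+p^n}{2}$, $p^n+1$ and $\frac{p^{2n}-p^n}{2}$, respectively. -/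

import Mathlib

/-- Undirected graphs without multiple edges, with loops allowed, on the vertex type `V`. -/
structure LoopGraph (V : Type*) where
  Adj : V → V → Prop
  symm : ∀ x y, Adj x y → Adj y x

namespace LoopGraph

/-- Isomorphisms of graphs with loops: bijections of the vertices that preserve and reflect
adjacency (hence also loops). -/
abbrev Iso {V W : Type*} (G : LoopGraph V) (H : LoopGraph W) := G.Adj ≃r H.Adj

/-- `K°_m`: the complete graph on `m` vertices with all the loops. -/
def completeLoop (m : ℕ) : LoopGraph (Fin m) where
  Adj _ _ := True
  symm _ _ _ := trivial

/-- The disjoint union `G ∪ H`. -/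
def disjUnion {V W : Type*} (G : LoopGraph V) (H : LoopGraph W) : LoopGraph (V ⊕ W) where
  Adj
    | Sum.inl x, Sum.inl y => G.Adj x y
    | Sum.inr x, Sum.inr y => H.Adj x y
    | _, _ => False
  symm := by
    rintro (x | x) (y | y) h
    · exact G.symm _ _ h
    · exact h
    · exact h
    · exact H.symm _ _ h

/-- The join `G ∨ H`: the disjoint union together with all edges between `G` and `H`. -/
def join {V W : Type*} (G : LoopGraph V) (H : LoopGraph W) : LoopGraph (V ⊕ W) where
  Adj
    | Sum.inl x, Sum.inl y => G.Adj x y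
    | Sum.inr x, Sum.inr y => H.Adj x y
    | _, _ => True
  symm := by
    rintro (x | x) (y | y) h
    · exact G.symm _ _ h
    · exact h
    · exact h
    · exact H.symm _ _ h

/-- `t G`: the disjoint union of `t` copies of `G`; the vertex `(i, x)` is the vertex `x` of the
`i`-th copy. -/
def copies {V : Type*} (t : ℕ) (G : LoopGraph V) : LoopGraph (Fin t × V) where
  Adj x y := x.1 = y.1 ∧ G.Adj x.2 y.2
  symm _ _ h := ⟨h.1.symm, G.symm _ _ h.2⟩

end LoopGraph

/-- Two elements are equivalent if each individually generates the same unital subring. In Mathlib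
`Subring.closure {a}` is the subring generated by `1` and `a`. -/
def unitalGenSetoid (R : Type*) [Ring R] : Setoid R where
  r a b := Subring.closure {a} = Subring.closure {b}
  iseqv := ⟨fun _ => rfl, fun h => h.symm, fun h k => h.trans k⟩

theorem commute_of_closure_eq {R : Type*} [Ring R] {a a' b b' : R}
    (ha : Subring.closure {a} = Subring.closure {a'})
    (hb : Subring.closure {b} = Subring.closure {b'}) (h : a * b = b * a) : a' * b' = b' * a' := by
  have key : ∀ x x' y : R, Subring.closure {x} = Subring.closure {x'} → x * y = y * x →
      x' * y = y * x' := by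
    intro x x' y hx hxy
    have h1 : Subring.closure {x} ≤ Subring.centralizer {y} := by
      rw [Subring.closure_le, Set.singleton_subset_iff, SetLike.mem_coe,
        Subring.mem_centralizer_iff]
      rintro z rfl
      exact hxy.symm
    have h2 : x' ∈ Subring.closure {x} := by
      rw [hx]
      exact Subring.subset_closure rfl
    exact (Subring.mem_centralizer_iff.1 (h1 h2) y rfl).symm
  exact (key b b' a' hb (key a a' b ha h).symm).symm

/-- The vertices of the unital compressed commuting graph: classes of ring elements that generate
the same unital subring. -/
abbrev UnitalClass (R : Type*) [Ring R] := Quotient (unitalGenSetoid R)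

/-- The class `[a]₁`. -/
def unitalClass {R : Type*} [Ring R] (a : R) : UnitalClass R := Quotient.mk (unitalGenSetoid R) a

/-- The unital compressed commuting graph `Λ¹(R)`: `[a]₁` and `[b]₁` are adjacent if and only if
`a * b = b * a`. -/
def unitalCCG (R : Type*) [Ring R] : LoopGraph (UnitalClass R) where
  Adj := Quotient.lift₂ (fun a b : R => a * b = b * a) (fun _ _ _ _ ha hb =>
    propext ⟨commute_of_closure_eq ha hb, commute_of_closure_eq ha.symm hb.symm⟩)
  symm := by
    rintro ⟨a⟩ ⟨b⟩ h
    exact Eq.symm h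

/-- The number of positive divisors of `n`. -/
def numDiv (n : ℕ) : ℕ := n.divisors.card

/-- The sum of the positive divisors of `n`. -/
def sumDiv (n : ℕ) : ℕ := ∑ d ∈ n.divisors, d

/-- `a(n)`. For `n ≥ 1` we have `d(n) ≤ d(n)²` and `1 ≤ σ(n)`, so no subtraction truncates. -/
def cliqueA (p n : ℕ) : ℕ :=
  if p = 2 ∧ Even n then numDiv n ^ 2 - numDiv n + sumDiv n - 1
  else numDiv n ^ 2 - numDiv n + sumDiv n

/-- `b(n)`. The divisions are exact, since `p ^ d - 1` divides `p ^ n - 1` whenever `d ∣ n`. -/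
def cliqueB (p n : ℕ) : ℕ := ∑ d ∈ n.divisors, (p ^ n - 1) / (p ^ d - 1)

/-- `c(n)`. Every divisor of `n` divides `2 * n`, so the subtraction does not truncate. -/
def cliqueC (n : ℕ) : ℕ := numDiv (2 * n) - numDiv n

/-- The number `(p²ⁿ + pⁿ) / 2` (the division is exact). -/
def countA (p n : ℕ) : ℕ := (p ^ (2 * n) + p ^ n) / 2

/-- The number `pⁿ + 1`. -/
def countB (p n : ℕ) : ℕ := p ^ n + 1

/-- The number `(p²ⁿ - pⁿ) / 2` (the division is exact). -/
def countC (p n : ℕ) : ℕ := (p ^ (2 * n) - p ^ n) / 2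

/-- The graph `K°_{d(n)} ∨ ((p²ⁿ + pⁿ)/2 K°_{a(n)} ∪ (pⁿ + 1) K°_{b(n)} ∪ (p²ⁿ - pⁿ)/2 K°_{c(n)})`. -/
def modelGraph (p n : ℕ) : LoopGraph (Fin (numDiv n) ⊕
    ((Fin (countA p n) × Fin (cliqueA p n) ⊕ Fin (countB p n) × Fin (cliqueB p n)) ⊕
      Fin (countC p n) × Fin (cliqueC n))) :=
  (LoopGraph.completeLoop (numDiv n)).join
    ((((LoopGraph.completeLoop (cliqueA p n)).copies (countA p n)).disjUnion
        ((LoopGraph.completeLoop (cliqueB p n)).copies (countB p n))).disjUnion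
      ((LoopGraph.completeLoop (cliqueC n)).copies (countC p n)))

section MatrixTypes

variable {F : Type*} [Field F]

/-- Non-scalar and diagonalizable: the minimal polynomial has two distinct roots in `F`. -/
def IsDiagType (A : Matrix (Fin 2) (Fin 2) F) : Prop :=
  ∃ x y : F, x ≠ y ∧
    minpoly F A = (Polynomial.X - Polynomial.C x) * (Polynomial.X - Polynomial.C y)

/-- Non-semisimple: the minimal polynomial has two equal roots in `F`. -/
def IsNonsemisimpleType (A : Matrix (Fin 2) (Fin 2) F) : Prop :=
  ∃ x : F, minpoly F A = (Polynomial.X - Polynomial.C x) ^ 2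

/-- Irreducible type: a non-central matrix whose minimal polynomial is irreducible over `F`. -/
def IsIrredType (A : Matrix (Fin 2) (Fin 2) F) : Prop :=
  A ∉ Subring.center (Matrix (Fin 2) (Fin 2) F) ∧ Irreducible (minpoly F A)

/-- The set of the centralizers of the matrices that satisfy `P`. -/
def centralizersOf (P : Matrix (Fin 2) (Fin 2) F → Prop) :
    Set (Subring (Matrix (Fin 2) (Fin 2) F)) :=
  {S | ∃ A, P A ∧ S = Subring.centralizer {A}}

end MatrixTypes

/-! Write q = p ^ n. The centralizer of a non-central 2×2 matrix A is F1 + FA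
(`exists_eq_smul_one_add_smul`). Hence commuting is an equivalence relation on non-central matrices,
and its classes are the sets of matrices with a common centralizer. Central matrices commute with
everything. So the graph is a join of the central classes with a disjoint union of cliques, one for
each centralizer, and only two counts remain.

Number of cliques: each centralizer has q(q - 1) non-central elements, so there are (q⁴ - q)/(q² -
q) = q² + q + 1 centralizers. Those of diagonalizable type contain two non-scalar idempotents each,
out of q(q + 1); those of non-semisimple type contain q - 1 nonzero nilpotents each, out of q² - 1.
The irreducible type takes the rest.

Size of a clique: a vertex is a subring with a single generator, and a centralizer is a copy of F ×
F, F[ε] or GF(q²). What has to be counted is the singly generated subrings whose generator lies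
outside the scalars. - In F itself they are the subfields, one for each divisor of n
(`ncard_closure_singleton`). - In F × F, two non-conjugate coordinates generate a product of
subfields, while conjugate ones generate the graph of a power of Frobenius on a subfield
(`ncard_closure_pair`). The product GF(4) × GF(4) is not singly generated, whence the exception for
p = 2 and n even. - In F[ε], a + bε generates S + bSε with S the subfield generated by a
(`ncard_closure_snd_ne_zero`). - In GF(q²) they are the subfields not contained in GF(q)
(`ncard_closure_singleton_notMem`). -/

theorem Set.ncard_eq_ncard_image_mul {α β : Type*} [Finite α] (f : α → β) (s : Set α) (k : ℕ)
    (h : ∀ a ∈ s, {b | b ∈ s ∧ f b = f a}.ncard = k) : s.ncard = (f '' s).ncard * k := by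
  classical
  have := Fintype.ofFinite α
  rw [Set.ncard_eq_toFinset_card', Set.ncard_eq_toFinset_card', Set.toFinset_image,
    Finset.card_eq_sum_card_image f, Finset.sum_const_nat]
  intro b hb
  obtain ⟨a, ha, rfl⟩ := Finset.mem_image.1 hb
  rw [← h a (by simpa using ha), Set.ncard_eq_toFinset_card']
  congr 1
  ext c
  simp

/-! ### Centralizers and types of 2×2 matrices -/

section TwoByTwo

open Polynomial Matrix

variable {F : Type*} [Field F]

theorem mem_center_iff_exists_smul_one {A : Matrix (Fin 2) (Fin 2) F} :
    A ∈ Subring.center (Matrix (Fin 2) (Fin 2) F) ↔ ∃ x : F, A = x • 1 := by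
  rw [← SetLike.mem_coe, Subring.coe_center, Matrix.center_eq_range]
  simp only [Set.mem_range, Matrix.scalar_apply, Matrix.smul_one_eq_diagonal, eq_comm]

theorem mem_center_iff_mem_range_algebraMap {A : Matrix (Fin 2) (Fin 2) F} :
    A ∈ Subring.center (Matrix (Fin 2) (Fin 2) F) ↔
      A ∈ (algebraMap F (Matrix (Fin 2) (Fin 2) F)).range := by
  rw [mem_center_iff_exists_smul_one, RingHom.mem_range]
  simp only [Algebra.algebraMap_eq_smul_one, eq_comm]

theorem smul_one_mem_center (x : F) :
    x • (1 : Matrix (Fin 2) (Fin 2) F) ∈ Subring.center (Matrix (Fin 2) (Fin 2) F) :=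
  mem_center_iff_exists_smul_one.2 ⟨x, rfl⟩

theorem smul_one_add_smul_mem_center_iff {A : Matrix (Fin 2) (Fin 2) F}
    (hA : A ∉ Subring.center (Matrix (Fin 2) (Fin 2) F)) (x y : F) :
    x • 1 + y • A ∈ Subring.center (Matrix (Fin 2) (Fin 2) F) ↔ y = 0 := by
  constructor
  · intro h
    by_contra hy
    obtain ⟨z, hz⟩ := mem_center_iff_exists_smul_one.1 h
    apply hA
    rw [mem_center_iff_exists_smul_one]
    refine ⟨y⁻¹ * (z - x), ?_⟩
    have : y • A = (z - x) • 1 := by rw [sub_smul, ← hz]; abel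
    rw [mul_smul, ← this, smul_smul, inv_mul_cancel₀ hy, one_smul]
  · rintro rfl
    simpa using smul_one_mem_center x

theorem smul_one_add_smul_inj {A : Matrix (Fin 2) (Fin 2) F}
    (hA : A ∉ Subring.center (Matrix (Fin 2) (Fin 2) F)) {x y z w : F}
    (h : x • 1 + y • A = z • 1 + w • A) : x = z ∧ y = w := by
  have h1 : y - w = 0 := by
    rw [← smul_one_add_smul_mem_center_iff hA 0 (y - w)]
    convert smul_one_mem_center (z - x) using 1
    rw [sub_smul, sub_smul, zero_smul, zero_add, sub_eq_sub_iff_add_eq_add, add_comm, h, add_comm]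
  rw [sub_eq_zero] at h1
  subst h1
  have h2 := congrFun (congrFun (add_right_cancel (G := Matrix (Fin 2) (Fin 2) F) h) 0) 0
  simpa using h2

/-- If A has a nonzero off-diagonal entry, y is the ratio of the corresponding entries of B and A.
Otherwise A is diagonal with distinct entries, so B is diagonal too and x + yT interpolates its
entries. -/
theorem exists_eq_smul_one_add_smul {A B : Matrix (Fin 2) (Fin 2) F}
    (hA : A ∉ Subring.center (Matrix (Fin 2) (Fin 2) F)) (h : A * B = B * A) :
    ∃ x y : F, B = x • 1 + y • A := by
  have e00 := congrFun (congrFun h 0) 0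
  have e01 := congrFun (congrFun h 0) 1
  have e10 := congrFun (congrFun h 1) 0
  simp only [Matrix.mul_apply, Fin.sum_univ_two] at e00 e01 e10
  by_cases hb : A 0 1 = 0
  · by_cases hc : A 1 0 = 0
    · have hd : A 0 0 - A 1 1 ≠ 0 := by
        intro hd
        refine hA (mem_center_iff_exists_smul_one.2 ⟨A 0 0, ?_⟩)
        ext i j
        fin_cases i <;> fin_cases j <;> simp [hb, hc]
        linear_combination -hd
      have h01 : B 0 1 = 0 := by
        apply mul_left_cancel₀ hd
        rw [hb] at e01
        linear_combination e01
      have h10 : B 1 0 = 0 := by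
        apply mul_left_cancel₀ hd
        rw [hc] at e10
        linear_combination -e10
      refine ⟨B 0 0 - (B 0 0 - B 1 1) / (A 0 0 - A 1 1) * A 0 0,
        (B 0 0 - B 1 1) / (A 0 0 - A 1 1), ?_⟩
      ext i j
      fin_cases i <;> fin_cases j <;> simp [hb, hc, h01, h10]
      field_simp
      ring
    · refine ⟨B 0 0 - B 1 0 / A 1 0 * A 0 0, B 1 0 / A 1 0, ?_⟩
      ext i j
      fin_cases i <;> fin_cases j <;> simp <;> field_simp
      · linear_combination -e00
      · linear_combination -e10
  · refine ⟨B 0 0 - B 0 1 / A 0 1 * A 0 0, B 0 1 / A 0 1, ?_⟩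
    ext i j
    fin_cases i <;> fin_cases j <;> simp <;> field_simp
    · linear_combination e00
    · linear_combination e01

theorem mul_smul_one_add_smul_comm (A : Matrix (Fin 2) (Fin 2) F) (x y : F) :
    A * (x • 1 + y • A) = (x • 1 + y • A) * A := by
  simp [mul_add, add_mul]

theorem mem_centralizer_singleton_iff {A B : Matrix (Fin 2) (Fin 2) F} :
    B ∈ Subring.centralizer {A} ↔ A * B = B * A := by
  simp [Subring.mem_centralizer_iff]

theorem centralizer_eq_iff_of_notMem_center {A B : Matrix (Fin 2) (Fin 2) F}
    (hA : A ∉ Subring.center (Matrix (Fin 2) (Fin 2) F))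
    (hB : B ∉ Subring.center (Matrix (Fin 2) (Fin 2) F)) :
    Subring.centralizer {A} = Subring.centralizer {B} ↔ A * B = B * A := by
  constructor
  · intro h
    have : A ∈ Subring.centralizer {A} := mem_centralizer_singleton_iff.2 rfl
    rw [h, mem_centralizer_singleton_iff] at this
    exact this.symm
  · have key : ∀ {A B : Matrix (Fin 2) (Fin 2) F},
        A ∉ Subring.center (Matrix (Fin 2) (Fin 2) F) → A * B = B * A →
        Subring.centralizer {A} ≤ Subring.centralizer {B} := by
      intro A B hA h C hC
      obtain ⟨x, y, rfl⟩ := exists_eq_smul_one_add_smul hA h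
      rw [mem_centralizer_singleton_iff] at hC ⊢
      simp [mul_add, add_mul, hC]
    exact fun h => le_antisymm (key hA h) (key hB h.symm)

theorem centralizer_eq_top_iff {A : Matrix (Fin 2) (Fin 2) F} :
    Subring.centralizer {A} = ⊤ ↔ A ∈ Subring.center (Matrix (Fin 2) (Fin 2) F) := by
  rw [Subring.centralizer_eq_top_iff_subset, Set.singleton_subset_iff, SetLike.mem_coe]

/-- This parametrization by (x, y) with y ≠ 0 underlies every later count inside one centralizer. -/
theorem centralizer_eq_iff_exists {A B : Matrix (Fin 2) (Fin 2) F}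
    (hA : A ∉ Subring.center (Matrix (Fin 2) (Fin 2) F)) :
    Subring.centralizer {B} = Subring.centralizer {A} ↔
      ∃ x y : F, y ≠ 0 ∧ B = x • 1 + y • A := by
  constructor
  · intro h
    have hB : B ∉ Subring.center (Matrix (Fin 2) (Fin 2) F) := by
      rwa [← centralizer_eq_top_iff, h, centralizer_eq_top_iff]
    rw [eq_comm, centralizer_eq_iff_of_notMem_center hA hB] at h
    obtain ⟨x, y, rfl⟩ := exists_eq_smul_one_add_smul hA h
    exact ⟨x, y, fun hy => hB ((smul_one_add_smul_mem_center_iff hA x y).2 hy), rfl⟩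
  · rintro ⟨x, y, hy, rfl⟩
    rw [eq_comm, centralizer_eq_iff_of_notMem_center hA
      (fun h => hy ((smul_one_add_smul_mem_center_iff hA x y).1 h))]
    exact mul_smul_one_add_smul_comm A x y

theorem minpoly_natDegree_of_notMem_center {A : Matrix (Fin 2) (Fin 2) F}
    (hA : A ∉ Subring.center (Matrix (Fin 2) (Fin 2) F)) : (minpoly F A).natDegree = 2 := by
  apply le_antisymm
  · have := natDegree_le_of_dvd (Matrix.minpoly_dvd_charpoly A) A.charpoly_monic.ne_zero
    simpa [Matrix.charpoly_natDegree_eq_dim] using this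
  · rw [minpoly.two_le_natDegree_iff (Algebra.IsIntegral.isIntegral A),
      ← mem_center_iff_mem_range_algebraMap]
    exact hA

theorem notMem_center_of_minpoly_natDegree {A : Matrix (Fin 2) (Fin 2) F}
    (hA : (minpoly F A).natDegree = 2) : A ∉ Subring.center (Matrix (Fin 2) (Fin 2) F) := by
  rw [mem_center_iff_mem_range_algebraMap,
    ← minpoly.two_le_natDegree_iff (Algebra.IsIntegral.isIntegral A), hA]

theorem natDegree_X_sub_C_mul_X_sub_C (x y : F) : ((X - C x) * (X - C y)).natDegree = 2 := by
  rw [natDegree_mul (X_sub_C_ne_zero x) (X_sub_C_ne_zero y)]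
  simp

/-- A non-central matrix has minimal polynomial of degree 2, so any monic quadratic that annihilates
it is the minimal polynomial. -/
theorem minpoly_eq_mul_iff {A : Matrix (Fin 2) (Fin 2) F} {x y : F} :
    minpoly F A = (X - C x) * (X - C y) ↔
      A ∉ Subring.center (Matrix (Fin 2) (Fin 2) F) ∧ (A - x • 1) * (A - y • 1) = 0 := by
  have hev : aeval A ((X - C x) * (X - C y)) = (A - x • 1) * (A - y • 1) := by
    simp [Algebra.algebraMap_eq_smul_one]
  constructor
  · intro h
    refine ⟨notMem_center_of_minpoly_natDegree (h ▸ natDegree_X_sub_C_mul_X_sub_C x y), ?_⟩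
    rw [← hev, ← h, minpoly.aeval]
  · rintro ⟨hA, h⟩
    refine (eq_of_monic_of_dvd_of_natDegree_le
      (minpoly.monic (Algebra.IsIntegral.isIntegral A))
      ((monic_X_sub_C x).mul (monic_X_sub_C y)) (minpoly.dvd F A (hev.trans h)) ?_).symm
    rw [natDegree_X_sub_C_mul_X_sub_C, minpoly_natDegree_of_notMem_center hA]

/-- E = (A - y)/(x - y) is the projection onto the x-eigenspace along the y-eigenspace. Affine
expressions in an idempotent are easier to count and to transport than minimal polynomials. -/
theorem isDiagType_iff {A : Matrix (Fin 2) (Fin 2) F} :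
    IsDiagType A ↔ ∃ (x y : F) (E : Matrix (Fin 2) (Fin 2) F), y ≠ 0 ∧ E * E = E ∧
      E ∉ Subring.center (Matrix (Fin 2) (Fin 2) F) ∧ A = x • 1 + y • E := by
  constructor
  · rintro ⟨x, y, hxy, h⟩
    obtain ⟨hA, h⟩ := minpoly_eq_mul_iff.1 h
    have hne := sub_ne_zero.2 hxy
    have hE : (x - y)⁻¹ • (A - y • 1) = (-((x - y)⁻¹ * y)) • 1 + (x - y)⁻¹ • A := by
      rw [smul_sub, neg_smul, mul_smul]; abel
    refine ⟨y, x - y, (x - y)⁻¹ • (A - y • 1), hne, ?_, ?_, ?_⟩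
    · have h1 : (A - y • 1) * (A - y • 1) = (x - y) • (A - y • 1) := by
        rw [← sub_eq_zero, ← h, sub_smul]
        simp only [sub_mul, mul_sub, smul_mul_assoc, mul_smul_comm, mul_one, one_mul, smul_sub]
        rw [smul_comm x y]
        abel
      rw [smul_mul_smul_comm, h1, smul_smul]
      congr 1
      field_simp
    · rw [hE, smul_one_add_smul_mem_center_iff hA]
      exact inv_ne_zero hne
    · rw [smul_smul, mul_inv_cancel₀ hne, one_smul]
      abel
  · rintro ⟨x, y, E, hy, hE, hEc, rfl⟩
    refine ⟨x + y, x, by simpa using hy, minpoly_eq_mul_iff.2 ⟨?_, ?_⟩⟩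
    · rwa [smul_one_add_smul_mem_center_iff hEc]
    · rw [add_smul, add_sub_cancel_left, add_sub_add_left_eq_sub, ← smul_sub, smul_mul_smul_comm,
        sub_mul, hE, one_mul, sub_self, smul_zero]

theorem isNonsemisimpleType_iff {A : Matrix (Fin 2) (Fin 2) F} :
    IsNonsemisimpleType A ↔ ∃ (x : F) (N : Matrix (Fin 2) (Fin 2) F), N * N = 0 ∧
      N ∉ Subring.center (Matrix (Fin 2) (Fin 2) F) ∧ A = x • 1 + N := by
  unfold IsNonsemisimpleType
  simp only [pow_two, minpoly_eq_mul_iff]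
  constructor
  · rintro ⟨x, hA, h⟩
    refine ⟨x, A - x • 1, h, fun hN => hA ?_, by abel⟩
    simpa using add_mem hN (smul_one_mem_center x)
  · rintro ⟨x, N, hN, hNc, rfl⟩
    refine ⟨x, ?_, by simpa using hN⟩
    simpa using (smul_one_add_smul_mem_center_iff hNc x 1).not.2 one_ne_zero

theorem IsDiagType.notMem_center {A : Matrix (Fin 2) (Fin 2) F} (h : IsDiagType A) :
    A ∉ Subring.center (Matrix (Fin 2) (Fin 2) F) := by
  obtain ⟨x, y, -, h⟩ := h
  exact (minpoly_eq_mul_iff.1 h).1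

theorem IsNonsemisimpleType.notMem_center {A : Matrix (Fin 2) (Fin 2) F}
    (h : IsNonsemisimpleType A) : A ∉ Subring.center (Matrix (Fin 2) (Fin 2) F) := by
  obtain ⟨x, h⟩ := h
  rw [pow_two] at h
  exact (minpoly_eq_mul_iff.1 h).1

theorem IsDiagType.not_isNonsemisimpleType {A : Matrix (Fin 2) (Fin 2) F} (h : IsDiagType A) :
    ¬ IsNonsemisimpleType A := by
  rintro ⟨z, hz⟩
  obtain ⟨x, y, hxy, h⟩ := h
  rw [h] at hz
  have h1 := congrArg (eval x) hz
  have h2 := congrArg (eval y) hz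
  simp only [eval_mul, eval_sub, eval_X, eval_C, sub_self, zero_mul, mul_zero, eval_pow] at h1 h2
  have h1 := sub_eq_zero.1 (pow_eq_zero_iff two_ne_zero |>.1 h1.symm)
  have h2 := sub_eq_zero.1 (pow_eq_zero_iff two_ne_zero |>.1 h2.symm)
  exact hxy (h1.trans h2.symm)

/-- A monic quadratic is irreducible unless it has a root, and one root splits it into two linear
factors, equal or distinct. -/
theorem isIrredType_iff {A : Matrix (Fin 2) (Fin 2) F} :
    IsIrredType A ↔ A ∉ Subring.center (Matrix (Fin 2) (Fin 2) F) ∧ ¬ IsDiagType A ∧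
      ¬ IsNonsemisimpleType A := by
  unfold IsIrredType
  refine and_congr_right fun hA => ⟨fun h => ⟨?_, ?_⟩, fun ⟨h1, h2⟩ => ?_⟩
  · rintro ⟨x, y, -, hxy⟩
    rw [hxy] at h
    have := h.isUnit_or_isUnit rfl
    simp [not_isUnit_X_sub_C] at this
  · rintro ⟨x, hx⟩
    rw [hx, pow_two] at h
    have := h.isUnit_or_isUnit rfl
    simp [not_isUnit_X_sub_C] at this
  · have hm := minpoly.monic (A := F) (Algebra.IsIntegral.isIntegral A)
    have hd := minpoly_natDegree_of_notMem_center hA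
    rw [hm.irreducible_iff_roots_eq_zero_of_degree_le_three (by lia) (by lia)]
    by_contra hr
    obtain ⟨x, hx⟩ := Multiset.exists_mem_of_ne_zero hr
    obtain ⟨q, hq⟩ := dvd_iff_isRoot.2 (isRoot_of_mem_roots hx)
    have hqm : q.Monic := (monic_X_sub_C x).of_mul_monic_left (hq ▸ hm)
    have hqd : q.natDegree = 1 := by
      rw [hq, (monic_X_sub_C x).natDegree_mul hqm, natDegree_X_sub_C] at hd
      lia
    have hqe : q = X - C (-q.coeff 0) := by
      rw [hqm.eq_X_add_C hqd]
      simp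
    rw [hqe] at hq
    by_cases hxy : x = -q.coeff 0
    · rw [← hxy, ← pow_two] at hq
      exact h2 ⟨x, hq⟩
    · exact h1 ⟨x, _, hxy, hq⟩

/-- B is z + wA with w ≠ 0, and such substitutions preserve the normal form x + yE. With the
analogues for the other types, each centralizer has a well-defined type. -/
theorem isDiagType_of_centralizer_eq {A B : Matrix (Fin 2) (Fin 2) F}
    (h : Subring.centralizer {B} = Subring.centralizer {A}) (hA : IsDiagType A) :
    IsDiagType B := by
  obtain ⟨z, w, hw, rfl⟩ := (centralizer_eq_iff_exists hA.notMem_center).1 h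
  obtain ⟨x, y, E, hy, hE, hEc, rfl⟩ := isDiagType_iff.1 hA
  refine isDiagType_iff.2 ⟨z + w * x, w * y, E, mul_ne_zero hw hy, hE, hEc, ?_⟩
  simp only [smul_add, add_smul, smul_smul]
  abel

theorem isNonsemisimpleType_of_centralizer_eq {A B : Matrix (Fin 2) (Fin 2) F}
    (h : Subring.centralizer {B} = Subring.centralizer {A}) (hA : IsNonsemisimpleType A) :
    IsNonsemisimpleType B := by
  obtain ⟨z, w, hw, rfl⟩ := (centralizer_eq_iff_exists hA.notMem_center).1 h
  obtain ⟨x, N, hN, hNc, rfl⟩ := isNonsemisimpleType_iff.1 hA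
  refine isNonsemisimpleType_iff.2 ⟨z + w * x, w • N, ?_, ?_, ?_⟩
  · rw [smul_mul_smul_comm, hN, smul_zero]
  · simpa using (smul_one_add_smul_mem_center_iff hNc 0 w).not.2 hw
  · simp only [smul_add, add_smul, smul_smul]
    abel

theorem isIrredType_of_centralizer_eq {A B : Matrix (Fin 2) (Fin 2) F}
    (h : Subring.centralizer {B} = Subring.centralizer {A}) (hA : IsIrredType A) :
    IsIrredType B := by
  rw [isIrredType_iff] at hA ⊢
  refine ⟨?_, fun hB => hA.2.1 (isDiagType_of_centralizer_eq h.symm hB),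
    fun hB => hA.2.2 (isNonsemisimpleType_of_centralizer_eq h.symm hB)⟩
  rw [← centralizer_eq_top_iff, h, centralizer_eq_top_iff]
  exact hA.1

end TwoByTwo

/-! ### Numbers of centralizers of each type -/

section CentralizerCount

open Matrix

variable {F : Type*} [Field F]

theorem natCard_units_add_one [Finite F] : Nat.card Fˣ + 1 = Nat.card F := by
  have := Nat.card_units F
  have := Nat.card_pos (α := F)
  lia

theorem ncard_snd_ne_zero [Finite F] :
    {z : F × F | z.2 ≠ 0}.ncard = Nat.card F * Nat.card Fˣ := by
  have : {z : F × F | z.2 ≠ 0} = Set.range (fun z : F × Fˣ => (z.1, (z.2 : F))) := by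
    ext ⟨x, y⟩
    constructor
    · intro h
      exact ⟨(x, Units.mk0 y h), rfl⟩
    · rintro ⟨⟨a, b⟩, h⟩
      obtain ⟨rfl, rfl⟩ := Prod.mk.inj h
      exact b.ne_zero
  rw [this, ← Nat.card_coe_set_eq, Nat.card_range_of_injective, Nat.card_prod]
  rintro ⟨a, b⟩ ⟨c, d⟩ h
  obtain ⟨h1, h2⟩ := Prod.mk.inj h
  exact Prod.ext h1 (Units.ext h2)

theorem ncard_notMem_center [Finite F] :
    {A : Matrix (Fin 2) (Fin 2) F | A ∉ Subring.center (Matrix (Fin 2) (Fin 2) F)}.ncard +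
      Nat.card F = Nat.card F ^ 4 := by
  have h1 : (Subring.center (Matrix (Fin 2) (Fin 2) F) : Set (Matrix (Fin 2) (Fin 2) F)).ncard =
      Nat.card F := by
    have : (Subring.center (Matrix (Fin 2) (Fin 2) F) : Set (Matrix (Fin 2) (Fin 2) F)) =
        Set.range (fun x : F => x • (1 : Matrix (Fin 2) (Fin 2) F)) := by
      ext A
      rw [SetLike.mem_coe, mem_center_iff_exists_smul_one]
      simp [eq_comm]
    rw [this, ← Nat.card_coe_set_eq, Nat.card_range_of_injective]
    intro x y h
    simpa using congrFun (congrFun h 0) 0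
  have h2 := Set.ncard_add_ncard_compl
    (Subring.center (Matrix (Fin 2) (Fin 2) F) : Set (Matrix (Fin 2) (Fin 2) F))
  have h3 : Nat.card (Matrix (Fin 2) (Fin 2) F) = Nat.card F ^ 4 := by
    have : Nat.card (Matrix (Fin 2) (Fin 2) F) = Nat.card (Fin 2 → Fin 2 → F) := rfl
    rw [this, Nat.card_fun, Nat.card_fun, ← pow_mul, Nat.card_fin]
  rw [h1, h3] at h2
  rw [← h2, add_comm]
  rfl

theorem ncard_notMem_center_centralizer_eq [Finite F] {A : Matrix (Fin 2) (Fin 2) F}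
    (hA : A ∉ Subring.center (Matrix (Fin 2) (Fin 2) F)) :
    {B | B ∉ Subring.center (Matrix (Fin 2) (Fin 2) F) ∧
      Subring.centralizer {B} = Subring.centralizer {A}}.ncard = Nat.card F * Nat.card Fˣ := by
  have : {B | B ∉ Subring.center (Matrix (Fin 2) (Fin 2) F) ∧
      Subring.centralizer {B} = Subring.centralizer {A}} =
      (fun z : F × F => z.1 • 1 + z.2 • A) '' {z | z.2 ≠ 0} := by
    ext B
    simp only [Set.mem_ofPred_eq, Set.mem_image, Prod.exists, centralizer_eq_iff_exists hA]
    constructor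
    · rintro ⟨-, x, y, hy, rfl⟩
      exact ⟨x, y, hy, rfl⟩
    · rintro ⟨x, y, hy, rfl⟩
      exact ⟨(smul_one_add_smul_mem_center_iff hA x y).not.2 hy, x, y, hy, rfl⟩
  rw [this, Set.ncard_image_of_injective, ncard_snd_ne_zero]
  rintro ⟨a, b⟩ ⟨c, d⟩ h
  exact Prod.ext_iff.2 (smul_one_add_smul_inj hA h)

theorem ncard_centralizersOf_notMem_center [Finite F] :
    (centralizersOf (F := F) fun A => A ∉ Subring.center (Matrix (Fin 2) (Fin 2) F)).ncard =
      Nat.card F ^ 2 + Nat.card F + 1 := by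
  have h : centralizersOf (F := F) (fun A => A ∉ Subring.center (Matrix (Fin 2) (Fin 2) F)) =
      (fun A : Matrix (Fin 2) (Fin 2) F => Subring.centralizer {A}) ''
        {A | A ∉ Subring.center (Matrix (Fin 2) (Fin 2) F)} := by
    ext S
    simp [centralizersOf, eq_comm]
  have h1 := Set.ncard_eq_ncard_image_mul
    (fun A : Matrix (Fin 2) (Fin 2) F => Subring.centralizer {A})
    {A | A ∉ Subring.center (Matrix (Fin 2) (Fin 2) F)} _
    fun A hA => ncard_notMem_center_centralizer_eq hA
  have h2 := ncard_notMem_center (F := F)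
  have h3 := natCard_units_add_one (F := F)
  have h4 : 1 < Nat.card F := Finite.one_lt_card
  rw [h]
  rw [h1] at h2
  have h5 : 0 < Nat.card F * Nat.card Fˣ := Nat.mul_pos (by lia) (by lia)
  apply Nat.eq_of_mul_eq_mul_right h5
  apply Nat.add_right_cancel (m := Nat.card F)
  rw [h2, ← h3]
  ring

/-- If the upper right entry is nonzero, it and the upper left entry are free and determine the
rest: q(q - 1) matrices. If it vanishes, the diagonal is (1, 0) or (0, 1) and the lower left entry
is free: 2q matrices. -/
theorem ncard_idempotent [Finite F] :
    {E : Matrix (Fin 2) (Fin 2) F | E * E = E ∧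
      E ∉ Subring.center (Matrix (Fin 2) (Fin 2) F)}.ncard = Nat.card F * (Nat.card F + 1) := by
  have h3 := natCard_units_add_one (F := F)
  have : {E : Matrix (Fin 2) (Fin 2) F | E * E = E ∧
      E ∉ Subring.center (Matrix (Fin 2) (Fin 2) F)} =
      Set.range (Sum.elim
        (fun z : F × Fˣ => !![z.1, z.2; z.1 * (1 - z.1) * (z.2 : F)⁻¹, 1 - z.1])
        (fun z : Bool × F => if z.1 then !![1, 0; z.2, 0] else !![0, 0; z.2, 1])) := by
    ext E
    constructor
    · rintro ⟨hE, hc⟩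
      have e00 := congrFun (congrFun hE 0) 0
      have e01 := congrFun (congrFun hE 0) 1
      have e10 := congrFun (congrFun hE 1) 0
      have e11 := congrFun (congrFun hE 1) 1
      simp only [Matrix.mul_apply, Fin.sum_univ_two] at e00 e01 e10 e11
      by_cases hb : E 0 1 = 0
      · rw [hb] at e00 e11
        have f0 : E 0 0 = 0 ∨ E 0 0 = 1 := by
          rw [← sub_eq_zero (b := (1 : F)), ← mul_eq_zero]
          linear_combination e00
        have f1 : E 1 1 = 0 ∨ E 1 1 = 1 := by
          rw [← sub_eq_zero (b := (1 : F)), ← mul_eq_zero]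
          linear_combination e11
        rcases f0 with f0 | f0 <;> rcases f1 with f1 | f1
        · have hc0 : E 1 0 = 0 := by rw [f0, f1] at e10; linear_combination -e10
          refine (hc (mem_center_iff_exists_smul_one.2 ⟨0, ?_⟩)).elim
          ext i j
          fin_cases i <;> fin_cases j <;> simp [hb, hc0, f0, f1]
        · refine ⟨Sum.inr (false, E 1 0), ?_⟩
          ext i j
          fin_cases i <;> fin_cases j <;> simp [hb, f0, f1]
        · refine ⟨Sum.inr (true, E 1 0), ?_⟩
          ext i j
          fin_cases i <;> fin_cases j <;> simp [hb, f0, f1]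
        · have hc0 : E 1 0 = 0 := by rw [f0, f1] at e10; linear_combination e10
          refine (hc (mem_center_iff_exists_smul_one.2 ⟨1, ?_⟩)).elim
          ext i j
          fin_cases i <;> fin_cases j <;> simp [hb, hc0, f0, f1]
      · have f : E 1 1 = 1 - E 0 0 := by
          apply mul_left_cancel₀ hb
          linear_combination e01
        refine ⟨Sum.inl (E 0 0, Units.mk0 _ hb), ?_⟩
        ext i j
        fin_cases i <;> fin_cases j <;> simp [f]
        field_simp
        linear_combination -e00
    · rintro ⟨⟨a, b⟩ | ⟨t, c⟩, rfl⟩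
      · refine ⟨?_, ?_⟩
        · ext i j
          fin_cases i <;> fin_cases j <;> simp [Matrix.mul_apply] <;> field_simp <;> ring
        · rw [mem_center_iff_exists_smul_one]
          rintro ⟨x, hx⟩
          have := congrFun (congrFun hx 0) 1
          simp at this
      · cases t
        all_goals
          refine ⟨?_, ?_⟩
          · ext i j
            fin_cases i <;> fin_cases j <;> simp [Matrix.mul_apply]
          · rw [mem_center_iff_exists_smul_one]
            rintro ⟨x, hx⟩
            have h0 := congrFun (congrFun hx 0) 0
            have h1 := congrFun (congrFun hx 1) 1
            simp at h0 h1
            simp [← h0] at h1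
  rw [this, ← Nat.card_coe_set_eq, Nat.card_range_of_injective, Nat.card_sum, Nat.card_prod,
    Nat.card_prod, Nat.card_eq_fintype_card (α := Bool), Fintype.card_bool, ← h3]
  · ring
  · rintro (⟨a, b⟩ | ⟨t, c⟩) (⟨a', b'⟩ | ⟨t', c'⟩) h
    · have h0 := congrFun (congrFun h 0) 0
      have h1 := congrFun (congrFun h 0) 1
      simp at h0 h1
      simp [h0, Units.ext h1]
    · have h1 := congrFun (congrFun h 0) 1
      cases t' <;> simp at h1
    · have h1 := congrFun (congrFun h 0) 1
      cases t <;> simp at h1 <;> exact (b'.ne_zero h1.symm).elim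
    · have h0 := congrFun (congrFun h 0) 0
      have h1 := congrFun (congrFun h 1) 0
      cases t <;> cases t' <;> simp at h0 h1 <;> simp [h1]

/-- As for idempotents: q(q - 1) matrices with nonzero upper right entry, and q - 1 strictly lower
triangular ones. -/
theorem ncard_nilpotent [Finite F] :
    {N : Matrix (Fin 2) (Fin 2) F | N * N = 0 ∧
      N ∉ Subring.center (Matrix (Fin 2) (Fin 2) F)}.ncard = (Nat.card F + 1) * Nat.card Fˣ := by
  have h3 := natCard_units_add_one (F := F)
  have : {N : Matrix (Fin 2) (Fin 2) F | N * N = 0 ∧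
      N ∉ Subring.center (Matrix (Fin 2) (Fin 2) F)} =
      Set.range (Sum.elim
        (fun z : F × Fˣ => !![z.1, z.2; -(z.1 * z.1 * (z.2 : F)⁻¹), -z.1])
        (fun z : Fˣ => !![0, 0; (z : F), 0])) := by
    ext N
    constructor
    · rintro ⟨hN, hc⟩
      have e00 := congrFun (congrFun hN 0) 0
      have e01 := congrFun (congrFun hN 0) 1
      have e10 := congrFun (congrFun hN 1) 0
      have e11 := congrFun (congrFun hN 1) 1
      simp only [Matrix.mul_apply, Fin.sum_univ_two, Matrix.zero_apply] at e00 e01 e10 e11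
      by_cases hb : N 0 1 = 0
      · have f0 : N 0 0 = 0 := by simpa [hb] using e00
        have f1 : N 1 1 = 0 := by simpa [hb] using e11
        have hc0 : N 1 0 ≠ 0 := by
          intro hc0
          refine hc (mem_center_iff_exists_smul_one.2 ⟨0, ?_⟩)
          ext i j
          fin_cases i <;> fin_cases j <;> simp [hb, hc0, f0, f1]
        refine ⟨Sum.inr (Units.mk0 _ hc0), ?_⟩
        ext i j
        fin_cases i <;> fin_cases j <;> simp [hb, f0, f1]
      · have f : N 1 1 = - N 0 0 := by
          apply mul_left_cancel₀ hb
          linear_combination e01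
        refine ⟨Sum.inl (N 0 0, Units.mk0 _ hb), ?_⟩
        ext i j
        fin_cases i <;> fin_cases j <;> simp [f]
        field_simp
        linear_combination -e00
    · rintro ⟨⟨a, b⟩ | c, rfl⟩
      · refine ⟨?_, ?_⟩
        · ext i j
          fin_cases i <;> fin_cases j <;> simp [Matrix.mul_apply] <;> field_simp <;> ring
        · rw [mem_center_iff_exists_smul_one]
          rintro ⟨x, hx⟩
          have := congrFun (congrFun hx 0) 1
          simp at this
      · refine ⟨?_, ?_⟩
        · ext i j
          fin_cases i <;> fin_cases j <;> simp [Matrix.mul_apply]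
        · rw [mem_center_iff_exists_smul_one]
          rintro ⟨x, hx⟩
          have := congrFun (congrFun hx 1) 0
          simp at this
  rw [this, ← Nat.card_coe_set_eq, Nat.card_range_of_injective, Nat.card_sum, Nat.card_prod]
  · ring
  · rintro (⟨a, b⟩ | c) (⟨a', b'⟩ | c') h
    · have h0 := congrFun (congrFun h 0) 0
      have h1 := congrFun (congrFun h 0) 1
      simp at h0 h1
      simp [h0, Units.ext h1]
    · have h1 := congrFun (congrFun h 0) 1
      simp at h1
    · have h1 := congrFun (congrFun h 0) 1
      simp [eq_comm] at h1
    · have h1 := congrFun (congrFun h 1) 0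
      simp at h1
      simp [Units.ext h1]

theorem centralizersOf_isDiagType :
    centralizersOf (F := F) IsDiagType =
      (fun A : Matrix (Fin 2) (Fin 2) F => Subring.centralizer {A}) '' {E | E * E = E ∧
        E ∉ Subring.center (Matrix (Fin 2) (Fin 2) F)} := by
  ext S
  constructor
  · rintro ⟨A, hA, rfl⟩
    obtain ⟨x, y, E, hy, hE, hEc, rfl⟩ := isDiagType_iff.1 hA
    exact ⟨E, ⟨hE, hEc⟩, ((centralizer_eq_iff_exists hEc).2 ⟨x, y, hy, rfl⟩).symm⟩
  · rintro ⟨E, ⟨hE, hEc⟩, rfl⟩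
    exact ⟨E, isDiagType_iff.2 ⟨0, 1, E, one_ne_zero, hE, hEc, by simp⟩, rfl⟩

theorem centralizersOf_isNonsemisimpleType :
    centralizersOf (F := F) IsNonsemisimpleType =
      (fun A : Matrix (Fin 2) (Fin 2) F => Subring.centralizer {A}) '' {N | N * N = 0 ∧
        N ∉ Subring.center (Matrix (Fin 2) (Fin 2) F)} := by
  ext S
  constructor
  · rintro ⟨A, hA, rfl⟩
    obtain ⟨x, N, hN, hNc, rfl⟩ := isNonsemisimpleType_iff.1 hA
    exact ⟨N, ⟨hN, hNc⟩,
      ((centralizer_eq_iff_exists hNc).2 ⟨x, 1, one_ne_zero, by simp⟩).symm⟩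
  · rintro ⟨N, ⟨hN, hNc⟩, rfl⟩
    exact ⟨N, isNonsemisimpleType_iff.2 ⟨0, N, hN, hNc, by simp⟩, rfl⟩

/-- The only non-scalar idempotents of F1 + FE are E and 1 - E, so idempotents map two-to-one onto
these centralizers. -/
theorem ncard_centralizersOf_isDiagType [Finite F] :
    (centralizersOf (F := F) IsDiagType).ncard * 2 = Nat.card F * (Nat.card F + 1) := by
  rw [centralizersOf_isDiagType, ← ncard_idempotent (F := F), eq_comm]
  apply Set.ncard_eq_ncard_image_mul
  rintro E ⟨hE, hEc⟩
  have : {B | B ∈ {E : Matrix (Fin 2) (Fin 2) F | E * E = E ∧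
      E ∉ Subring.center (Matrix (Fin 2) (Fin 2) F)} ∧
      Subring.centralizer {B} = Subring.centralizer {E}} = {E, 1 - E} := by
    ext B
    simp only [Set.mem_ofPred_eq, Set.mem_insert_iff, Set.mem_singleton_iff,
      centralizer_eq_iff_exists hEc]
    constructor
    · rintro ⟨⟨h1, -⟩, x, y, hy, rfl⟩
      have h2 : (x * x) • (1 : Matrix (Fin 2) (Fin 2) F) + (2 * x * y + y * y) • E =
          x • 1 + y • E := by
        rw [← h1]
        simp only [add_mul, mul_add, smul_mul_smul_comm, hE, one_mul, mul_one, add_smul, two_mul,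
          mul_comm y x]
        abel
      obtain ⟨h3, h4⟩ := smul_one_add_smul_inj hEc h2
      have h5 : 2 * x + y = 1 := by
        apply mul_right_cancel₀ hy
        linear_combination h4
      have h6 : x = 0 ∨ x = 1 := by
        rw [← sub_eq_zero (b := (1 : F)), ← mul_eq_zero]
        linear_combination h3
      rcases h6 with rfl | rfl
      · left
        simp [show y = 1 by linear_combination h5]
      · right
        simp [show y = -1 by linear_combination h5, sub_eq_add_neg]
    · have hc : 1 - E ∉ Subring.center (Matrix (Fin 2) (Fin 2) F) := by
        intro h
        exact hEc (by simpa using sub_mem (one_mem _) h)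
      rintro (rfl | rfl)
      · exact ⟨⟨hE, hEc⟩, 0, 1, one_ne_zero, by simp⟩
      · refine ⟨⟨?_, hc⟩, 1, -1, neg_ne_zero.2 one_ne_zero, by simp [sub_eq_add_neg]⟩
        simp [mul_sub, sub_mul, hE]
  rw [this, Set.ncard_pair]
  intro h
  apply hEc
  -- This shows E ≠ 1 - E in every characteristic, since equality would give E = E(1 - E) = 0.
  have h1 : E * (1 - E) = E := by rw [← h, hE]
  rw [mul_sub, hE, mul_one, sub_self] at h1
  rw [← h1]
  exact zero_mem _

/-- The nonzero square-zero elements of F1 + FN are the nonzero multiples of N, q - 1 in number. -/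
theorem ncard_centralizersOf_isNonsemisimpleType [Finite F] :
    (centralizersOf (F := F) IsNonsemisimpleType).ncard = Nat.card F + 1 := by
  have h0 : 0 < Nat.card Fˣ := Nat.card_pos
  apply Nat.eq_of_mul_eq_mul_right h0
  rw [centralizersOf_isNonsemisimpleType, ← ncard_nilpotent (F := F), eq_comm]
  apply Set.ncard_eq_ncard_image_mul
  rintro N ⟨hN, hNc⟩
  have : {B | B ∈ {N : Matrix (Fin 2) (Fin 2) F | N * N = 0 ∧
      N ∉ Subring.center (Matrix (Fin 2) (Fin 2) F)} ∧
      Subring.centralizer {B} = Subring.centralizer {N}} =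
      Set.range (fun y : Fˣ => (0 : F) • 1 + (y : F) • N) := by
    ext B
    simp only [Set.mem_ofPred_eq, Set.mem_range, centralizer_eq_iff_exists hNc]
    constructor
    · rintro ⟨⟨h1, -⟩, x, y, hy, rfl⟩
      refine ⟨Units.mk0 y hy, ?_⟩
      have h2 : (x * x) • (1 : Matrix (Fin 2) (Fin 2) F) + (2 * x * y) • N =
          (0 : F) • 1 + (0 : F) • N := by
        rw [zero_smul, zero_smul, add_zero, ← h1]
        simp only [add_mul, mul_add, smul_mul_smul_comm, hN, one_mul, mul_one, add_smul, two_mul,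
          mul_comm y x, smul_zero]
        abel
      have h3 := (smul_one_add_smul_inj hNc h2).1
      rw [mul_self_eq_zero.1 h3, Units.val_mk0]
    · rintro ⟨y, rfl⟩
      refine ⟨⟨?_, ?_⟩, 0, y, y.ne_zero, rfl⟩
      · simp [hN]
      · rw [smul_one_add_smul_mem_center_iff hNc]
        exact y.ne_zero
  rw [this, ← Nat.card_coe_set_eq, Nat.card_range_of_injective]
  intro y z h
  exact Units.ext (smul_one_add_smul_inj hNc h).2

theorem ncard_centralizersOf_isIrredType [Finite F] :
    (centralizersOf (F := F) IsIrredType).ncard * 2 + Nat.card F = Nat.card F ^ 2 := by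
  have h : centralizersOf (F := F) (fun A => A ∉ Subring.center (Matrix (Fin 2) (Fin 2) F)) =
      (centralizersOf IsDiagType ∪ centralizersOf IsNonsemisimpleType) ∪
        centralizersOf IsIrredType := by
    ext S
    constructor
    · rintro ⟨A, hA, rfl⟩
      by_cases h1 : IsDiagType A
      · exact Or.inl (Or.inl ⟨A, h1, rfl⟩)
      by_cases h2 : IsNonsemisimpleType A
      · exact Or.inl (Or.inr ⟨A, h2, rfl⟩)
      exact Or.inr ⟨A, isIrredType_iff.2 ⟨hA, h1, h2⟩, rfl⟩
    · rintro ((⟨A, hA, rfl⟩ | ⟨A, hA, rfl⟩) | ⟨A, hA, rfl⟩)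
      · exact ⟨A, hA.notMem_center, rfl⟩
      · exact ⟨A, hA.notMem_center, rfl⟩
      · exact ⟨A, hA.1, rfl⟩
  have h1 := ncard_centralizersOf_notMem_center (F := F)
  rw [h, Set.ncard_union_eq ?_ (Set.toFinite _) (Set.toFinite _),
    Set.ncard_union_eq ?_ (Set.toFinite _) (Set.toFinite _),
    ncard_centralizersOf_isNonsemisimpleType] at h1
  · have h2 := ncard_centralizersOf_isDiagType (F := F)
    rw [mul_add, ← pow_two] at h2
    lia
  · rw [Set.disjoint_left]
    rintro S ⟨A, hA, rfl⟩ ⟨B, hB, hAB⟩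
    exact hA.not_isNonsemisimpleType (isNonsemisimpleType_of_centralizer_eq hAB hB)
  · rw [Set.disjoint_left]
    rintro S (⟨A, hA, rfl⟩ | ⟨A, hA, rfl⟩) ⟨B, hB, hAB⟩
    · exact (isIrredType_iff.1 (isIrredType_of_centralizer_eq hAB hB)).2.1 hA
    · exact (isIrredType_iff.1 (isIrredType_of_centralizer_eq hAB hB)).2.2 hA

end CentralizerCount

/-! ### Subrings of a finite field -/

section FrobeniusFixed

variable {K : Type*} [Field K] (p : ℕ) [Fact p.Prime] [CharP K p]

/-- The subring of the elements fixed by the `d`-th power of the Frobenius endomorphism. -/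
def frobeniusFixed (K : Type*) [Field K] (p : ℕ) [Fact p.Prime] [CharP K p] (d : ℕ) : Subring K :=
  (iterateFrobenius K p d).eqLocus (RingHom.id K)

variable {p}

theorem mem_frobeniusFixed {d : ℕ} {x : K} : x ∈ frobeniusFixed K p d ↔ x ^ p ^ d = x :=
  Iff.rfl

theorem pow_pow_mod_of_pow_eq {M : Type*} [Monoid M] {p d : ℕ} {x : M} (h : x ^ p ^ d = x)
    (k : ℕ) : x ^ p ^ k = x ^ p ^ (k % d) := by
  have key : ∀ j, x ^ p ^ (d * j) = x := by
    intro j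
    induction j with
    | zero => simp
    | succ j ih => rw [mul_add, mul_one, pow_add, pow_mul, ih, h]
  conv_lhs => rw [← Nat.div_add_mod k d, pow_add, pow_mul, key]

/-- A nonzero r would give x ^ (p ^ r - 1) = 1 with an exponent positive and below the order.
Elements of order p ^ d - 1 thus detect d. -/
theorem eq_zero_of_orderOf_eq {p d r : ℕ} (hp : p.Prime) {x : K} (hx : orderOf x = p ^ d - 1)
    (hx0 : x ≠ 0) (hr : r < d) (h : x ^ p ^ r = x) : r = 0 := by
  by_contra h0
  have h1 : 1 < p ^ r := Nat.one_lt_pow h0 hp.one_lt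
  have h2 : p ^ r < p ^ d := Nat.pow_lt_pow_right hp.one_lt hr
  have h3 : x ^ (p ^ r - 1) = 1 := by
    apply mul_right_cancel₀ hx0
    rw [← pow_succ, Nat.sub_add_cancel h1.le, h, one_mul]
  have h4 := Nat.le_of_dvd (by lia) (orderOf_dvd_of_pow_eq_one h3)
  lia

/-- The elements are roots of X ^ p ^ d - X. For d = 0 this polynomial vanishes and the subring is
all of K. -/
theorem natCard_frobeniusFixed_le {d : ℕ} (hd : d ≠ 0) :
    Nat.card (frobeniusFixed K p d) ≤ p ^ d := by
  classical
  have hp1 := (Fact.out : p.Prime).one_lt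
  have hne := FiniteField.X_pow_card_pow_sub_X_ne_zero K hd hp1
  have hdeg := FiniteField.X_pow_card_pow_sub_X_natDegree_eq K hd hp1
  have hsub : (frobeniusFixed K p d : Set K) ⊆
      ((Polynomial.X ^ p ^ d - Polynomial.X : Polynomial K).roots.toFinset : Set K) := by
    intro x hx
    rw [SetLike.mem_coe, mem_frobeniusFixed] at hx
    simp [hne, hx]
  have h1 := Set.ncard_le_ncard hsub (Finset.finite_toSet _)
  rw [Set.ncard_coe_finset] at h1
  calc Nat.card (frobeniusFixed K p d) = (frobeniusFixed K p d : Set K).ncard :=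
        Nat.card_coe_set_eq _
    _ ≤ _ := h1
    _ ≤ _ := Multiset.toFinset_card_le _
    _ ≤ _ := Polynomial.card_roots' _
    _ = p ^ d := hdeg

/-- Inverses in a finite field are powers, so S is a subfield, and K is a vector space over it. The
elements of S are fixed by x ↦ x ^ |S|, and the root bound leaves no room for others. -/
theorem exists_natCard_and_eq_frobeniusFixed [Finite K] {m : ℕ} (hK : Nat.card K = p ^ m)
    (S : Subring K) : ∃ d ∈ m.divisors, Nat.card S = p ^ d ∧ S = frobeniusFixed K p d := by
  classical
  have hp : p.Prime := Fact.out
  have : Fintype K := Fintype.ofFinite K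
  have hinv : ∀ x ∈ S, x⁻¹ ∈ S := by
    intro x hx
    by_cases hx0 : x = 0
    · simp [hx0]
    · have h2 : 1 < Fintype.card K := Fintype.one_lt_card
      have : x⁻¹ = x ^ (Fintype.card K - 2) := by
        apply inv_eq_of_mul_eq_one_right
        rw [← pow_succ', ← FiniteField.pow_card_sub_one_eq_one x hx0]
        congr 1
        lia
      rw [this]
      exact pow_mem hx _
  let T : Subfield K := { S with inv_mem' := hinv }
  have : Fintype T := Fintype.ofFinite T
  have hc := Module.card_eq_pow_finrank (K := T) (V := K)
  rw [← Nat.card_eq_fintype_card, hK] at hc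
  have hfr : Module.finrank T K ≠ 0 := Module.finrank_pos.ne'
  obtain ⟨d, hdm, hd⟩ := (Nat.dvd_prime_pow hp).1 (hc ▸ dvd_pow_self _ hfr :
    Fintype.card T ∣ p ^ m)
  rw [hd, ← pow_mul] at hc
  have hm := Nat.pow_right_injective hp.two_le hc
  have hm0 : m ≠ 0 := by
    rintro rfl
    have := Finite.one_lt_card (α := K)
    rw [hK] at this
    simp at this
  have hd0 : d ≠ 0 := by
    rintro rfl
    simp at hm
    exact hm0 hm
  have hST : Nat.card S = p ^ d := by
    rw [← hd, ← Nat.card_eq_fintype_card]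
    rfl
  refine ⟨d, Nat.mem_divisors.2 ⟨⟨_, hm⟩, hm0⟩, hST, ?_⟩
  apply SetLike.coe_injective
  apply Set.eq_of_subset_of_ncard_le
  · intro x hx
    have h := FiniteField.pow_card (⟨x, hx⟩ : T)
    rw [hd] at h
    exact congrArg Subtype.val h
  · have := natCard_frobeniusFixed_le (K := K) (p := p) hd0
    rw [← hST] at this
    exact this
  · exact Set.toFinite _

theorem exists_orderOf_eq [Finite K] {m : ℕ} (hK : Nat.card K = p ^ m) {d : ℕ}
    (hd : d ∈ m.divisors) : ∃ x : K, x ≠ 0 ∧ orderOf x = p ^ d - 1 := by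
  obtain ⟨g, hg⟩ := IsCyclic.exists_ofOrder_eq_natCard (α := Kˣ)
  rw [Nat.card_units, hK] at hg
  obtain ⟨hdm, hm⟩ := Nat.mem_divisors.1 hd
  have hp : p.Prime := Fact.out
  have h1 : 1 < p ^ m := Nat.one_lt_pow hm hp.one_lt
  have hdvd : p ^ d - 1 ∣ orderOf g := by
    obtain ⟨k, rfl⟩ := hdm
    rw [hg, pow_mul]
    simpa using Nat.sub_dvd_pow_sub_pow (p ^ d) 1 k
  refine ⟨((g ^ (orderOf g / (p ^ d - 1)) : Kˣ) : K), Units.ne_zero _, ?_⟩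
  rw [orderOf_units]
  exact orderOf_pow_orderOf_div (by lia) hdvd

/-- Zero and the powers of x already give p ^ d elements, the maximum possible. -/
theorem closure_eq_frobeniusFixed [Finite K] {d : ℕ} (hd0 : d ≠ 0) {x : K} (hx0 : x ≠ 0) (hx : orderOf x = p ^ d - 1) :
    Subring.closure {x} = frobeniusFixed K p d := by
  have hp : p.Prime := Fact.out
  have h1 : 1 < p ^ d := Nat.one_lt_pow hd0 hp.one_lt
  have hxS : x ∈ Subring.closure {x} := Subring.subset_closure rfl
  apply SetLike.coe_injective
  apply Set.eq_of_subset_of_ncard_le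
  · rw [SetLike.coe_subset_coe, Subring.closure_le, Set.singleton_subset_iff, SetLike.mem_coe,
      mem_frobeniusFixed]
    conv_lhs => rw [← Nat.sub_add_cancel h1.le, pow_succ, ← hx, pow_orderOf_eq_one, one_mul]
  · refine (natCard_frobeniusFixed_le (K := K) (p := p) hd0).trans ?_
    have hsub : insert 0 ((fun i => x ^ i) '' Set.Iio (orderOf x)) ⊆
        (Subring.closure {x} : Set K) := by
      rw [Set.insert_subset_iff]
      refine ⟨zero_mem _, ?_⟩
      rintro _ ⟨i, -, rfl⟩
      exact pow_mem hxS i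
    refine le_trans ?_ (Set.ncard_le_ncard hsub (Set.toFinite _))
    rw [Set.ncard_insert_of_notMem, pow_injOn_Iio_orderOf.ncard_image, hx,
      Set.ncard_eq_toFinset_card']
    · simp
      lia
    · rintro ⟨i, -, hi⟩
      exact pow_ne_zero i hx0 hi
  · exact Set.toFinite _

theorem natCard_frobeniusFixed [Finite K] {m : ℕ} (hK : Nat.card K = p ^ m) {d : ℕ}
    (hd : d ∈ m.divisors) : Nat.card (frobeniusFixed K p d) = p ^ d := by
  have hp : p.Prime := Fact.out
  obtain ⟨x, hx0, hx⟩ := exists_orderOf_eq hK hd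
  obtain ⟨e, he, h1, h2⟩ := exists_natCard_and_eq_frobeniusFixed (p := p) hK
    (frobeniusFixed K p d)
  obtain ⟨h3, -⟩ := Nat.mem_divisors.1 hd
  have hxe : x ^ p ^ e = x := by
    rw [← mem_frobeniusFixed, ← h2, ← closure_eq_frobeniusFixed (Nat.pos_of_mem_divisors hd).ne' hx0 hx]
    exact Subring.subset_closure rfl
  have hle : p ^ e ≤ p ^ d := h1 ▸ natCard_frobeniusFixed_le (K := K) (p := p)
    (Nat.pos_of_mem_divisors hd).ne'
  rcases (Nat.pow_le_pow_iff_right hp.one_lt).1 hle |>.lt_or_eq with h | h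
  · exact absurd (eq_zero_of_orderOf_eq hp hx hx0 h hxe) (Nat.pos_of_mem_divisors he).ne'
  · rw [h1, h]

theorem frobeniusFixed_injOn [Finite K] {m : ℕ} (hK : Nat.card K = p ^ m) :
    Set.InjOn (frobeniusFixed K p) m.divisors := by
  intro d hd e he h
  have h1 := natCard_frobeniusFixed hK hd
  rw [h, natCard_frobeniusFixed hK he] at h1
  exact (Nat.pow_right_injective (Fact.out : p.Prime).two_le h1).symm

/-- An element of order p ^ d - 1 fixed by the e-th power of Frobenius is fixed by the (e mod d)-th,
so the remainder is zero. -/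
theorem frobeniusFixed_le_iff [Finite K] {m : ℕ} (hK : Nat.card K = p ^ m) {d e : ℕ}
    (hd : d ∈ m.divisors) : frobeniusFixed K p d ≤ frobeniusFixed K p e ↔ d ∣ e := by
  constructor
  · intro h
    obtain ⟨x, hx0, hx⟩ := exists_orderOf_eq hK hd
    have h1 : x ∈ frobeniusFixed K p d := by
      rw [← closure_eq_frobeniusFixed (Nat.pos_of_mem_divisors hd).ne' hx0 hx]
      exact Subring.subset_closure rfl
    have h2 : x ^ p ^ (e % d) = x := by
      rw [← pow_pow_mod_of_pow_eq (mem_frobeniusFixed.1 h1)]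
      exact h h1
    exact Nat.dvd_of_mod_eq_zero (eq_zero_of_orderOf_eq Fact.out hx hx0
      (Nat.mod_lt _ (Nat.pos_of_mem_divisors hd)) h2)
  · rintro ⟨k, rfl⟩ x hx
    rw [mem_frobeniusFixed] at hx ⊢
    rw [pow_pow_mod_of_pow_eq hx]
    simp

theorem exists_closure_eq_frobeniusFixed [Finite K] {m : ℕ} (hK : Nat.card K = p ^ m) (x : K) :
    ∃ d ∈ m.divisors, Subring.closure {x} = frobeniusFixed K p d := by
  obtain ⟨d, hd, -, h⟩ := exists_natCard_and_eq_frobeniusFixed (p := p) hK (Subring.closure {x})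
  exact ⟨d, hd, h⟩

theorem exists_eq_closure [Finite K] {m : ℕ} (hK : Nat.card K = p ^ m) {d : ℕ}
    (hd : d ∈ m.divisors) : ∃ x : K, Subring.closure {x} = frobeniusFixed K p d := by
  obtain ⟨x, hx0, hx⟩ := exists_orderOf_eq hK hd
  exact ⟨x, closure_eq_frobeniusFixed (Nat.pos_of_mem_divisors hd).ne' hx0 hx⟩

theorem ncard_closure_singleton [Finite K] {m : ℕ} (hK : Nat.card K = p ^ m) :
    {S : Subring K | ∃ x, S = Subring.closure {x}}.ncard = numDiv m := by
  have : {S : Subring K | ∃ x, S = Subring.closure {x}} = frobeniusFixed K p '' m.divisors := by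
    ext S
    constructor
    · rintro ⟨x, rfl⟩
      obtain ⟨d, hd, h⟩ := exists_closure_eq_frobeniusFixed (p := p) hK x
      exact ⟨d, hd, h.symm⟩
    · rintro ⟨d, hd, rfl⟩
      obtain ⟨x, hx⟩ := exists_eq_closure hK hd
      exact ⟨x, hx.symm⟩
  rw [this, (frobeniusFixed_injOn hK).ncard_image, Set.ncard_coe_finset, numDiv]

theorem ncard_closure_singleton_notMem [Finite K] {n : ℕ} (hn : n ≠ 0)
    (hK : Nat.card K = p ^ (2 * n)) :
    {S : Subring K | ∃ x, x ∉ frobeniusFixed K p n ∧ S = Subring.closure {x}}.ncard =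
      cliqueC n := by
  have hsub : n.divisors ⊆ (2 * n).divisors :=
    Nat.divisors_subset_of_dvd (by lia) (dvd_mul_left n 2)
  have key : ∀ (x : K) (d : ℕ), d ∈ (2 * n).divisors →
      Subring.closure {x} = frobeniusFixed K p d →
      (x ∉ frobeniusFixed K p n ↔ d ∈ (2 * n).divisors \ n.divisors) := by
    intro x d hd h
    rw [Finset.mem_sdiff, Nat.mem_divisors (m := n), ← frobeniusFixed_le_iff hK hd, ← h,
      Subring.closure_le, Set.singleton_subset_iff, SetLike.mem_coe]
    tauto
  have : {S : Subring K | ∃ x, x ∉ frobeniusFixed K p n ∧ S = Subring.closure {x}} =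
      frobeniusFixed K p '' ((2 * n).divisors \ n.divisors : Finset ℕ) := by
    ext S
    constructor
    · rintro ⟨x, hx, rfl⟩
      obtain ⟨d, hd, h⟩ := exists_closure_eq_frobeniusFixed (p := p) hK x
      exact ⟨d, (key x d hd h).1 hx, h.symm⟩
    · rintro ⟨d, hd, rfl⟩
      obtain ⟨x, hx⟩ := exists_eq_closure hK (Finset.mem_sdiff.1 hd).1
      exact ⟨x, (key x d (Finset.mem_sdiff.1 hd).1 hx).2 hd, hx.symm⟩
  rw [this, Set.InjOn.ncard_image, Set.ncard_coe_finset, Finset.card_sdiff_of_subset hsub]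
  · rfl
  · exact (frobeniusFixed_injOn hK).mono (Finset.coe_subset.2 Finset.sdiff_subset)

end FrobeniusFixed

/-! ### Singly generated subrings of F × F -/

section ProductSubrings

variable {K : Type*} [Field K] {p : ℕ} [Fact p.Prime] [CharP K p]

theorem aeval_mem_closure_of_intCast_surjective {A R : Type*} [CommRing A] [CommRing R]
    [Algebra A R] (hA : Function.Surjective (Int.cast : ℤ → A)) (f : Polynomial A) (r : R) :
    Polynomial.aeval r f ∈ Subring.closure {r} := by
  rw [Polynomial.aeval_eq_sum_range]
  refine sum_mem fun i _ => ?_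
  obtain ⟨c, hc⟩ := hA (f.coeff i)
  rw [Algebra.smul_def, ← hc, map_intCast]
  have hr : r ∈ Subring.closure {r} := Subring.subset_closure (Set.mem_singleton r)
  exact mul_mem (intCast_mem _ _) (pow_mem hr i)

/-- Non-conjugate elements have coprime minimal polynomials over the prime field. A Bézout
combination then puts the idempotent (1, 0) into the subring, which splits it into its two
projections. -/
theorem closure_singleton_prod [Finite K] {x y : K} (h : ∀ k, y ≠ x ^ p ^ k) :
    Subring.closure {(x, y)} = (Subring.closure {x}).prod (Subring.closure {y}) := by
  let _ : Algebra (ZMod p) K := ZMod.algebra K p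
  have hx : IsIntegral (ZMod p) x := Algebra.IsIntegral.isIntegral x
  have hy : IsIntegral (ZMod p) y := Algebra.IsIntegral.isIntegral y
  have hne : minpoly (ZMod p) x ≠ minpoly (ZMod p) y := by
    intro he
    obtain ⟨σ, hσ⟩ := isConjRoot_iff_exists_algEquiv.1
      (show IsConjRoot (ZMod p) y x from he.symm)
    obtain ⟨k, rfl⟩ := (FiniteField.bijective_frobeniusAlgEquivOfAlgebraic_pow (ZMod p) K).2 σ
    apply h k
    rw [← hσ, AlgEquiv.coe_pow, FiniteField.coe_frobeniusAlgEquivOfAlgebraic_iterate, ZMod.card]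
  have hcop : IsCoprime (minpoly (ZMod p) x) (minpoly (ZMod p) y) := by
    rw [(minpoly.irreducible hx).coprime_iff_not_dvd]
    intro hdvd
    exact hne (Polynomial.eq_of_monic_of_associated (minpoly.monic hx) (minpoly.monic hy)
      ((minpoly.irreducible hx).associated_of_dvd (minpoly.irreducible hy) hdvd))
  obtain ⟨u, v, huv⟩ := hcop
  have h10 : ((1, 0) : K × K) ∈ Subring.closure {(x, y)} := by
    -- This Bézout term is 1 at x and 0 at y.
    have h1 : Polynomial.aeval x (v * minpoly (ZMod p) y) = 1 := by
      rw [← Polynomial.aeval_one (R := ZMod p) x, ← huv]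
      simp
    have h2 : Polynomial.aeval y (v * minpoly (ZMod p) y) = 0 := by simp
    have := aeval_mem_closure_of_intCast_surjective ZMod.intCast_surjective
      (v * minpoly (ZMod p) y) (x, y)
    rwa [Polynomial.aeval_prod_apply, h1, h2] at this
  apply le_antisymm
  · rw [Subring.closure_le, Set.singleton_subset_iff, SetLike.mem_coe, Subring.mem_prod]
    exact ⟨Subring.subset_closure rfl, Subring.subset_closure rfl⟩
  · rintro ⟨a, b⟩ hab
    rw [Subring.mem_prod] at hab
    obtain ⟨ha, hb⟩ := hab
    have hfst : (Subring.closure {(x, y)}).map (RingHom.fst K K) = Subring.closure {x} := by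
      rw [RingHom.map_closure, Set.image_singleton]; rfl
    have hsnd : (Subring.closure {(x, y)}).map (RingHom.snd K K) = Subring.closure {y} := by
      rw [RingHom.map_closure, Set.image_singleton]; rfl
    obtain ⟨⟨a', w⟩, hw, rfl⟩ := Subring.mem_map.1 (hfst ▸ ha)
    obtain ⟨⟨w', b'⟩, hw', rfl⟩ := Subring.mem_map.1 (hsnd ▸ hb)
    have := add_mem (mul_mem hw h10) (mul_mem hw' (sub_mem (one_mem _) h10))
    rwa [mul_sub, mul_one, Prod.mk_mul_mk, Prod.mk_mul_mk, Prod.mk_sub_mk, Prod.mk_add_mk, mul_one,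
      mul_zero, mul_one, mul_zero, sub_self, sub_zero, add_zero, zero_add] at this

/-- The graph of the `k`-th power of the Frobenius endomorphism on `frobeniusFixed K p d`. -/
def frobeniusGraph (K : Type*) [Field K] (p : ℕ) [Fact p.Prime] [CharP K p] (d k : ℕ) :
    Subring (K × K) :=
  (frobeniusFixed K p d).map ((RingHom.id K).prod (iterateFrobenius K p k))

theorem mem_frobeniusGraph {d k : ℕ} {x y : K} :
    (x, y) ∈ frobeniusGraph K p d k ↔ x ∈ frobeniusFixed K p d ∧ y = x ^ p ^ k := by
  rw [frobeniusGraph, Subring.mem_map]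
  constructor
  · rintro ⟨z, hz, h⟩
    obtain ⟨rfl, rfl⟩ := Prod.mk.inj h
    exact ⟨hz, rfl⟩
  · rintro ⟨hx, rfl⟩
    exact ⟨x, hx, rfl⟩

theorem closure_pair_pow_eq_frobeniusGraph {d k : ℕ} {x : K}
    (hx : Subring.closure {x} = frobeniusFixed K p d) :
    Subring.closure {(x, x ^ p ^ k)} = frobeniusGraph K p d k := by
  rw [frobeniusGraph, ← hx, RingHom.map_closure, Set.image_singleton]
  rfl

theorem natCard_closure_pow [Finite K] {d k : ℕ} {x : K}
    (hx : Subring.closure {x} = frobeniusFixed K p d) :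
    Nat.card (Subring.closure {x ^ p ^ k}) = Nat.card (frobeniusFixed K p d) := by
  have h : Subring.closure {x ^ p ^ k} =
      (frobeniusFixed K p d).map (iterateFrobenius K p k) := by
    rw [← hx, RingHom.map_closure, Set.image_singleton]
    rfl
  rw [h]
  exact Nat.card_image_of_injective (RingHom.injective _) _

theorem closure_zero_eq_frobeniusFixed_one [Finite K] {m : ℕ} (hK : Nat.card K = p ^ m) :
    Subring.closure {(0 : K)} = frobeniusFixed K p 1 := by
  obtain ⟨d, hd, h⟩ := exists_closure_eq_frobeniusFixed (p := p) hK (0 : K)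
  have h0 : (0 : K) ∈ frobeniusFixed K p 1 := zero_mem _
  have hle : frobeniusFixed K p d ≤ frobeniusFixed K p 1 := by
    rw [← h, Subring.closure_le, Set.singleton_subset_iff]
    exact h0
  rw [h, Nat.dvd_one.1 ((frobeniusFixed_le_iff hK hd).1 hle)]

/-- For d ≠ e the generated fields have different sizes. For d = e = 1 take 0 and 1. For d = e ≥ 2
take x of order p ^ d - 1 and its inverse: conjugacy would make p ^ d - 1 divide p ^ r + 1 with r <
d, which forces p = d = 2. -/
theorem exists_not_conj_closure_eq [Finite K] {m : ℕ} (hK : Nat.card K = p ^ m) {d e : ℕ}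
    (hd : d ∈ m.divisors) (he : e ∈ m.divisors) (hne : ¬ (p = 2 ∧ d = 2 ∧ e = 2)) :
    ∃ x y : K, (∀ k, y ≠ x ^ p ^ k) ∧ Subring.closure {x} = frobeniusFixed K p d ∧
      Subring.closure {y} = frobeniusFixed K p e := by
  have hp : p.Prime := Fact.out
  by_cases hde : d = e
  · subst hde
    have hd0 : d ≠ 0 := (Nat.pos_of_mem_divisors hd).ne'
    by_cases hd1 : d = 1
    · subst hd1
      have h0 := closure_zero_eq_frobeniusFixed_one (p := p) hK
      refine ⟨0, 1, fun k => ?_, h0, ?_⟩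
      · rw [zero_pow (pow_ne_zero _ hp.ne_zero)]
        exact one_ne_zero
      · rw [← h0]
        apply le_antisymm
        · rw [Subring.closure_le, Set.singleton_subset_iff]
          exact one_mem _
        · rw [Subring.closure_le, Set.singleton_subset_iff]
          exact zero_mem _
    · obtain ⟨x, hx0, hx⟩ := exists_orderOf_eq hK hd
      have hxc := closure_eq_frobeniusFixed hd0 hx0 hx
      have hxi : orderOf x⁻¹ = p ^ d - 1 := by
        rw [← hx, ← Units.val_mk0 hx0, ← Units.val_inv_eq_inv_val, orderOf_units, orderOf_units,
          orderOf_inv]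
      refine ⟨x, x⁻¹, fun k hk => ?_, hxc, closure_eq_frobeniusFixed hd0 (inv_ne_zero hx0) hxi⟩
      have hxm : x ^ p ^ d = x := by
        rw [← mem_frobeniusFixed, ← hxc]
        exact Subring.subset_closure rfl
      rw [pow_pow_mod_of_pow_eq hxm] at hk
      have hlt : k % d < d := Nat.mod_lt _ (Nat.pos_of_ne_zero hd0)
      generalize k % d = r at hk hlt
      have h1 : x ^ (p ^ r + 1) = 1 := by
        rw [pow_succ, ← hk, inv_mul_cancel₀ hx0]
      have h2 := orderOf_dvd_of_pow_eq_one h1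
      rw [hx] at h2
      have h3 := Nat.le_of_dvd (by lia) h2
      have h4 : p ^ r ≤ p ^ (d - 1) := Nat.pow_le_pow_right hp.pos (by lia)
      obtain ⟨e, rfl⟩ : ∃ e, d = e + 2 := ⟨d - 2, by lia⟩
      have h5 : p ^ (e + 2) = p ^ (e + 1) * p := pow_succ _ _
      have h6 : p ^ (e + 1) = p ^ e * p := pow_succ _ _
      have h7 : 0 < p ^ e := Nat.pow_pos hp.pos
      have h3 : p ^ (e + 1) * p ≤ p ^ (e + 1) + 2 := by
        rw [show e + 2 - 1 = e + 1 by lia] at h4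
        lia
      have h8 : p ^ (e + 1) ≤ 2 ∧ p = 2 := by
        have h9 : 2 ≤ p ^ (e + 1) := by nlinarith [hp.two_le]
        have : p = 2 := by
          by_contra h
          have : 3 ≤ p := by have := hp.two_le; lia
          nlinarith
        subst this
        lia
      obtain ⟨h8, rfl⟩ := h8
      have : e = 0 := by
        by_contra h
        have := Nat.one_lt_two_pow h
        lia
      subst this
      exact hne ⟨rfl, rfl, rfl⟩
  · obtain ⟨x, hx⟩ := exists_eq_closure hK hd
    obtain ⟨y, hy⟩ := exists_eq_closure hK he
    refine ⟨x, y, ?_, hx, hy⟩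
    rintro k rfl
    have := natCard_closure_pow (k := k) hx
    rw [hy, natCard_frobeniusFixed hK hd, natCard_frobeniusFixed hK he] at this
    exact hde (Nat.pow_right_injective hp.two_le this).symm

/-- Generators of GF(4) are roots of T² + T + 1, and the two roots x and x² are conjugate. -/
theorem conj_of_char_two {K : Type*} [Field K] [Finite K] [CharP K 2] {m : ℕ}
    (hK : Nat.card K = 2 ^ m) (h2 : 2 ∈ m.divisors) {x y : K}
    (hx : Subring.closure {x} = frobeniusFixed K 2 2)
    (hy : Subring.closure {y} = frobeniusFixed K 2 2) : ∃ k, y = x ^ 2 ^ k := by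
  have h1 : 1 ∈ m.divisors := Nat.one_mem_divisors.2 (Nat.mem_divisors.1 h2).2
  have key : ∀ z : K, Subring.closure {z} = frobeniusFixed K 2 2 → z * z + z + 1 = 0 := by
    intro z hz
    have hzm : z ^ 2 ^ 2 = z := by
      rw [← mem_frobeniusFixed, ← hz]
      exact Subring.subset_closure rfl
    have hzn : z ∉ frobeniusFixed K 2 1 := by
      intro h
      have h3 : frobeniusFixed K 2 2 ≤ frobeniusFixed K 2 1 := by
        rwa [← hz, Subring.closure_le, Set.singleton_subset_iff]
      have := (frobeniusFixed_le_iff hK h2).1 h3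
      lia
    have hzn : z * z - z ≠ 0 := by
      rw [mem_frobeniusFixed] at hzn
      intro h
      apply hzn
      linear_combination h
    -- (z² - z)(z² + z + 1) = z⁴ - z.
    apply mul_left_cancel₀ hzn
    linear_combination hzm
  have hx := key x hx
  have hy := key y hy
  have : (y - x) * (y - x ^ 2) = 0 := by
    have h2 : (2 : K) = 0 := CharTwo.two_eq_zero
    linear_combination hy + (x - y - 1) * hx
  rcases mul_eq_zero.1 this with h | h
  · exact ⟨0, by simpa using sub_eq_zero.1 h⟩
  · exact ⟨1, by simpa using sub_eq_zero.1 h⟩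

/-- The Frobenius graphs contribute d - 1 subrings for each divisor d, in total σ(n) - d(n). The
products contribute d(n)² pairs of subfields, less the pair (GF(4), GF(4)) when p = 2 and n is even.
-/
theorem ncard_closure_pair [Finite K] {n : ℕ} (hn : n ≠ 0) (hK : Nat.card K = p ^ n) :
    {S : Subring (K × K) | ∃ z, z.1 ≠ z.2 ∧ S = Subring.closure {z}}.ncard = cliqueA p n := by
  have hp : p.Prime := Fact.out
  -- The exponent 0 is left out: it gives the diagonal, whose elements correspond to scalars.
  set I : Finset (Σ _ : ℕ, ℕ) := n.divisors.sigma fun d => Finset.Ico 1 d with hI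
  set J : Finset (ℕ × ℕ) :=
    {z ∈ n.divisors ×ˢ n.divisors | ¬ (p = 2 ∧ z = (2, 2))} with hJ
  have hset : {S : Subring (K × K) | ∃ z, z.1 ≠ z.2 ∧ S = Subring.closure {z}} =
      (fun i : Σ _ : ℕ, ℕ => frobeniusGraph K p i.1 i.2) '' I ∪
        (fun i : ℕ × ℕ => (frobeniusFixed K p i.1).prod (frobeniusFixed K p i.2)) '' J := by
    ext S
    constructor
    · rintro ⟨⟨x, y⟩, hxy, rfl⟩
      obtain ⟨d, hd, hx⟩ := exists_closure_eq_frobeniusFixed (p := p) hK x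
      by_cases hc : ∃ k, y = x ^ p ^ k
      · left
        obtain ⟨k, rfl⟩ := hc
        have hxm : x ^ p ^ d = x := by
          rw [← mem_frobeniusFixed, ← hx]
          exact Subring.subset_closure rfl
        rw [pow_pow_mod_of_pow_eq hxm] at hxy ⊢
        refine ⟨⟨d, k % d⟩, ?_, (closure_pair_pow_eq_frobeniusGraph hx).symm⟩
        rw [hI, Finset.mem_coe, Finset.mem_sigma, Finset.mem_Ico]
        refine ⟨hd, Nat.one_le_iff_ne_zero.2 fun h => ?_,
          Nat.mod_lt _ (Nat.pos_of_mem_divisors hd)⟩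
        have h : k % d = 0 := h
        rw [h] at hxy
        simp at hxy
      · right
        obtain ⟨e, he, hy⟩ := exists_closure_eq_frobeniusFixed (p := p) hK y
        refine ⟨(d, e), ?_, ?_⟩
        · rw [hJ, Finset.mem_coe, Finset.mem_filter, Finset.mem_product]
          refine ⟨⟨hd, he⟩, ?_⟩
          rintro ⟨rfl, h⟩
          obtain ⟨rfl, rfl⟩ := Prod.mk.inj h
          exact hc (conj_of_char_two hK hd hx hy)
        · rw [closure_singleton_prod (not_exists.1 hc), hx, hy]
    · rintro (⟨⟨d, k⟩, hi, rfl⟩ | ⟨⟨d, e⟩, hi, rfl⟩)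
      · rw [hI, Finset.mem_coe, Finset.mem_sigma, Finset.mem_Ico] at hi
        obtain ⟨x, hx0, hx⟩ := exists_orderOf_eq hK hi.1
        refine ⟨(x, x ^ p ^ k), fun h => ?_, (closure_pair_pow_eq_frobeniusGraph
          (closure_eq_frobeniusFixed (Nat.pos_of_mem_divisors hi.1).ne' hx0 hx)).symm⟩
        have := eq_zero_of_orderOf_eq hp hx hx0 hi.2.2 h.symm
        have := hi.2.1
        lia
      · rw [hJ, Finset.mem_coe, Finset.mem_filter, Finset.mem_product] at hi
        obtain ⟨x, y, hxy, hx, hy⟩ := exists_not_conj_closure_eq hK hi.1.1 hi.1.2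
          (fun h => hi.2 ⟨h.1, Prod.ext h.2.1 h.2.2⟩)
        refine ⟨(x, y), fun h => hxy 0 ?_, ?_⟩
        · simpa using h.symm
        · rw [closure_singleton_prod hxy, hx, hy]
  have hdisj : Disjoint ((fun i : Σ _ : ℕ, ℕ => frobeniusGraph K p i.1 i.2) '' (I : Set _))
      ((fun i : ℕ × ℕ => (frobeniusFixed K p i.1).prod (frobeniusFixed K p i.2)) ''
        (J : Set _)) := by
    rw [Set.disjoint_left]
    rintro S ⟨⟨d, k⟩, -, rfl⟩ ⟨⟨d', e⟩, -, h⟩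
    -- A product contains (1, 0); the graph of a ring homomorphism does not.
    have h1 : ((1, 0) : K × K) ∈ (frobeniusFixed K p d').prod (frobeniusFixed K p e) :=
      ⟨one_mem _, zero_mem _⟩
    have h2 : ((1, 0) : K × K) ∈ frobeniusGraph K p d k := h.le h1
    have h3 := (mem_frobeniusGraph.1 h2).2
    simp at h3
  have hinjI : Set.InjOn (fun i : Σ _ : ℕ, ℕ => frobeniusGraph K p i.1 i.2) I := by
    rintro ⟨d, k⟩ hi ⟨e, l⟩ hj h
    rw [hI, Finset.mem_coe, Finset.mem_sigma, Finset.mem_Ico] at hi hj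
    have hfst : ∀ d k, (frobeniusGraph K p d k).map (RingHom.fst K K) =
        frobeniusFixed K p d := by
      intro d k
      rw [frobeniusGraph, Subring.map_map]
      exact Subring.map_id _
    have hde : d = e := by
      apply frobeniusFixed_injOn hK hi.1 hj.1
      rw [← hfst d k, ← hfst e l]
      exact congrArg _ h
    subst hde
    obtain ⟨x, hx0, hx⟩ := exists_orderOf_eq hK hi.1
    have hxm : x ∈ frobeniusFixed K p d := by
      rw [← closure_eq_frobeniusFixed (Nat.pos_of_mem_divisors hi.1).ne' hx0 hx]
      exact Subring.subset_closure rfl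
    have key : ∀ k l : ℕ, k ≤ l → l < d → x ^ p ^ k = x ^ p ^ l → k = l := by
      intro k l hkl hl hpow
      obtain ⟨j, rfl⟩ := Nat.exists_eq_add_of_le hkl
      rw [add_comm k j, pow_add, pow_mul] at hpow
      have h1 : x ^ p ^ j = x := (iterateFrobenius_inj K p k hpow).symm
      have := eq_zero_of_orderOf_eq hp hx hx0 (by lia) h1
      lia
    have h1 : (x, x ^ p ^ k) ∈ frobeniusGraph K p d l := by
      have : (x, x ^ p ^ k) ∈ frobeniusGraph K p d k := mem_frobeniusGraph.2 ⟨hxm, rfl⟩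
      exact h.le this
    have h2 := (mem_frobeniusGraph.1 h1).2
    rcases le_total k l with hkl | hkl
    · rw [key k l hkl hj.2.2 h2]
    · rw [key l k hkl hi.2.2 h2.symm]
  have hinjJ : Set.InjOn
      (fun i : ℕ × ℕ => (frobeniusFixed K p i.1).prod (frobeniusFixed K p i.2)) J := by
    rintro ⟨d, e⟩ hi ⟨d', e'⟩ hj h
    rw [hJ, Finset.mem_coe, Finset.mem_filter, Finset.mem_product] at hi hj
    have key : ∀ S T S' T' : Subring K, S.prod T = S'.prod T' → S = S' ∧ T = T' := by
      intro S T S' T' h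
      constructor
      · ext x
        have := SetLike.ext_iff.1 h (x, 0)
        simpa [Subring.mem_prod, zero_mem] using this
      · ext x
        have := SetLike.ext_iff.1 h (0, x)
        simpa [Subring.mem_prod, zero_mem] using this
    obtain ⟨h1, h2⟩ := key _ _ _ _ h
    exact Prod.ext (frobeniusFixed_injOn hK hi.1.1 hj.1.1 h1)
      (frobeniusFixed_injOn hK hi.1.2 hj.1.2 h2)
  have hcardI : I.card + numDiv n = sumDiv n := by
    rw [hI, Finset.card_sigma, numDiv, Finset.card_eq_sum_ones, ← Finset.sum_add_distrib, sumDiv]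
    refine Finset.sum_congr rfl fun d hd => ?_
    rw [Nat.card_Ico, Nat.sub_add_cancel (Nat.pos_of_mem_divisors hd)]
  have hcardJ : J.card + (if p = 2 ∧ Even n then 1 else 0) = numDiv n ^ 2 := by
    have h1 : (n.divisors ×ˢ n.divisors).card = numDiv n ^ 2 := by
      rw [Finset.card_product, numDiv, pow_two]
    have h2 := Finset.card_filter_add_card_filter_not (s := n.divisors ×ˢ n.divisors)
      (fun z => ¬ (p = 2 ∧ z = (2, 2)))
    rw [h1] at h2
    rw [← h2, hJ]
    congr 1
    simp only [not_not]
    split_ifs with h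
    · obtain ⟨rfl, h⟩ := h
      rw [eq_comm, Finset.card_eq_one]
      refine ⟨(2, 2), ?_⟩
      ext z
      simp only [Finset.mem_filter, Finset.mem_singleton, Finset.mem_product, Nat.mem_divisors,
        true_and]
      constructor
      · exact fun h => h.2
      · rintro rfl
        exact ⟨⟨⟨h.two_dvd, hn⟩, h.two_dvd, hn⟩, rfl⟩
    · rw [eq_comm, Finset.card_eq_zero, Finset.filter_eq_empty_iff]
      rintro z hz ⟨h2, rfl⟩
      rw [Finset.mem_product] at hz
      exact h ⟨h2, even_iff_two_dvd.2 (Nat.mem_divisors.1 hz.1).1⟩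
  rw [hset, Set.ncard_union_eq hdisj (Set.toFinite _) (Set.toFinite _), hinjI.ncard_image,
    hinjJ.ncard_image, Set.ncard_coe_finset, Set.ncard_coe_finset, cliqueA]
  have h1 : 1 ≤ numDiv n := Finset.card_pos.2 (Nat.nonempty_divisors.2 hn)
  have h2 : numDiv n ≤ numDiv n ^ 2 := Nat.le_self_pow two_ne_zero _
  split_ifs at hcardJ ⊢ <;> lia

end ProductSubrings

/-! ### Singly generated subrings of the dual numbers -/

section DualNumberSubrings

variable {K : Type*} [Field K]

/-- The subring `S + c S ε` of the dual numbers. -/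
def dualSubring (S : Subring K) (c : K) : Subring (DualNumber K) where
  carrier := {r | r.fst ∈ S ∧ ∃ v ∈ S, r.snd = c * v}
  zero_mem' := ⟨zero_mem S, 0, zero_mem S, by simp⟩
  one_mem' := ⟨one_mem S, 0, zero_mem S, by simp⟩
  add_mem' := by
    rintro r s ⟨hr, v, hv, h⟩ ⟨hs, w, hw, h'⟩
    exact ⟨add_mem hr hs, v + w, add_mem hv hw, by rw [TrivSqZeroExt.snd_add, h, h', mul_add]⟩
  neg_mem' := by
    rintro r ⟨hr, v, hv, h⟩
    exact ⟨neg_mem hr, -v, neg_mem hv, by rw [TrivSqZeroExt.snd_neg, h, mul_neg]⟩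
  mul_mem' := by
    rintro r s ⟨hr, v, hv, h⟩ ⟨hs, w, hw, h'⟩
    refine ⟨mul_mem hr hs, r.fst * w + v * s.fst,
      add_mem (mul_mem hr hw) (mul_mem hv hs), ?_⟩
    rw [DualNumber.snd_mul, h, h']
    ring

theorem mem_dualSubring {S : Subring K} {c : K} {r : DualNumber K} :
    r ∈ dualSubring S c ↔ r.fst ∈ S ∧ ∃ v ∈ S, r.snd = c * v := Iff.rfl

theorem dualSubring_map_fst (S : Subring K) (c : K) :
    (dualSubring S c).map (TrivSqZeroExt.fstHom K K K).toRingHom = S := by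
  ext x
  rw [Subring.mem_map]
  constructor
  · rintro ⟨r, hr, rfl⟩
    exact hr.1
  · intro hx
    exact ⟨TrivSqZeroExt.inl x, ⟨hx, 0, zero_mem S, by simp⟩, rfl⟩

/-- In characteristic p the power (a + bε) ^ p ^ n equals a, so the subring contains a and bε
separately. -/
theorem closure_singleton_eq_dualSubring [Finite K] {p : ℕ} [CharP K p] {n : ℕ} (hn : n ≠ 0)
    (hK : Nat.card K = p ^ n) (r : DualNumber K) :
    Subring.closure {r} = dualSubring (Subring.closure {r.fst}) r.snd := by
  have hr : r ∈ Subring.closure {r} := Subring.subset_closure (Set.mem_singleton r)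
  apply le_antisymm
  · rw [Subring.closure_le, Set.singleton_subset_iff, SetLike.mem_coe]
    exact ⟨Subring.subset_closure (Set.mem_singleton _), 1, one_mem _, (mul_one _).symm⟩
  · have hinl : TrivSqZeroExt.inl r.fst ∈ Subring.closure {r} := by
      have : TrivSqZeroExt.inl r.fst = r ^ p ^ n := by
        apply TrivSqZeroExt.ext
        · have := Fintype.ofFinite K
          rw [TrivSqZeroExt.fst_inl, TrivSqZeroExt.fst_pow, ← hK, Nat.card_eq_fintype_card,
            FiniteField.pow_card]
        · rw [TrivSqZeroExt.snd_inl, TrivSqZeroExt.snd_pow, nsmul_eq_mul, Nat.cast_pow,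
            CharP.cast_eq_zero, zero_pow hn, zero_mul]
      rw [this]
      exact pow_mem hr _
    have hinr : TrivSqZeroExt.inr r.snd ∈ Subring.closure {r} := by
      have : TrivSqZeroExt.inr r.snd = r - TrivSqZeroExt.inl r.fst := by
        rw [eq_sub_iff_add_eq, add_comm, TrivSqZeroExt.inl_fst_add_inr_snd_eq]
      rw [this]
      exact sub_mem hr hinl
    have hmap : ∀ x ∈ Subring.closure {r.fst}, TrivSqZeroExt.inl x ∈ Subring.closure {r} := by
      have : Subring.closure {r.fst} ≤
          (Subring.closure {r}).comap (TrivSqZeroExt.inlHom K K) := by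
        rw [Subring.closure_le, Set.singleton_subset_iff]
        exact hinl
      exact this
    rintro s ⟨h1, v, hv, h2⟩
    have : s = TrivSqZeroExt.inl s.fst + TrivSqZeroExt.inr r.snd * TrivSqZeroExt.inl v := by
      apply TrivSqZeroExt.ext
      · simp
      · simp [h2, mul_comm]
    rw [this]
    exact add_mem (hmap _ h1) (mul_mem hinr (hmap _ hv))

theorem dualSubring_eq_iff {S : Subring K} (hS : ∀ x ∈ S, x⁻¹ ∈ S) (b c : Kˣ) :
    dualSubring S (b : K) = dualSubring S c ↔ ∃ v ∈ S, (b : K) = c * v := by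
  constructor
  · intro h
    have : TrivSqZeroExt.inr (b : K) ∈ dualSubring S (b : K) :=
      ⟨zero_mem S, 1, one_mem S, (mul_one _).symm⟩
    rw [h] at this
    exact this.2
  · rintro ⟨v, hv, h⟩
    have hv0 : v ≠ 0 := by
      rintro rfl
      exact b.ne_zero (h.trans (mul_zero _))
    ext r
    rw [mem_dualSubring, mem_dualSubring]
    refine and_congr_right fun _ => ⟨?_, ?_⟩
    · rintro ⟨w, hw, h'⟩
      exact ⟨v * w, mul_mem hv hw, by rw [h', h, mul_assoc]⟩
    · rintro ⟨w, hw, h'⟩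
      refine ⟨v⁻¹ * w, mul_mem (hS v hv) hw, ?_⟩
      rw [h', h, mul_assoc, mul_inv_cancel_left₀ hv0]

theorem inv_mem_frobeniusFixed {p : ℕ} [Fact p.Prime] [CharP K p] {d : ℕ} (x : K)
    (hx : x ∈ frobeniusFixed K p d) : x⁻¹ ∈ frobeniusFixed K p d := by
  rw [mem_frobeniusFixed] at hx ⊢
  rw [inv_pow, hx]

/-- S + cSε depends only on the coset of c modulo the nonzero elements of S, and each coset has p ^
d - 1 elements. -/
theorem ncard_range_dualSubring [Finite K] {p : ℕ} [Fact p.Prime] [CharP K p] {n : ℕ}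
    (hK : Nat.card K = p ^ n) {d : ℕ} (hd : d ∈ n.divisors) :
    (Set.range fun c : Kˣ => dualSubring (frobeniusFixed K p d) (c : K)).ncard =
      (p ^ n - 1) / (p ^ d - 1) := by
  have hp : p.Prime := Fact.out
  have h1 : 1 < p ^ d := Nat.one_lt_pow (Nat.pos_of_mem_divisors hd).ne' hp.one_lt
  apply Nat.eq_div_of_mul_eq_left (by lia)
  have h := Set.ncard_eq_ncard_image_mul
    (fun c : Kˣ => dualSubring (frobeniusFixed K p d) (c : K)) Set.univ (p ^ d - 1) ?_
  · rw [Set.image_univ, Set.ncard_univ, Nat.card_units, hK] at h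
    exact h.symm
  · intro c _
    simp only [Set.mem_univ, true_and, dualSubring_eq_iff inv_mem_frobeniusFixed]
    have h2 : (frobeniusFixed K p d : Set K).ncard = p ^ d := natCard_frobeniusFixed hK hd
    rw [← h2, ← Set.ncard_sdiff_singleton_of_mem (zero_mem (frobeniusFixed K p d))]
    refine Set.ncard_congr (fun b _ => (c : K)⁻¹ * b) ?_ ?_ ?_
    · rintro b ⟨v, hv, hb⟩
      refine ⟨?_, fun h0 => ?_⟩
      · simpa [hb] using hv
      · simp at h0
    · intro b b' _ _ h
      exact Units.ext (mul_left_cancel₀ (inv_ne_zero c.ne_zero) h)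
    · rintro v ⟨hv, hv0⟩
      have hu : ((Units.mk0 v hv0 : Kˣ) : K) = v := Units.val_mk0 _
      exact ⟨c * Units.mk0 v hv0, ⟨v, hv, by rw [Units.val_mul, hu]⟩,
        by rw [Units.val_mul, hu, inv_mul_cancel_left₀ c.ne_zero]⟩

theorem ncard_closure_snd_ne_zero [Finite K] {p : ℕ} [Fact p.Prime] [CharP K p] {n : ℕ}
    (hn : n ≠ 0) (hK : Nat.card K = p ^ n) :
    {S : Subring (DualNumber K) | ∃ r : DualNumber K, r.snd ≠ 0 ∧
      S = Subring.closure {r}}.ncard = cliqueB p n := by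
  classical
  have hfin : ∀ d : ℕ, (Set.range fun c : Kˣ =>
      dualSubring (frobeniusFixed K p d) (c : K)).Finite := fun d => Set.finite_range _
  have hset : {S : Subring (DualNumber K) | ∃ r : DualNumber K, r.snd ≠ 0 ∧
      S = Subring.closure {r}} = (n.divisors.biUnion fun d => (hfin d).toFinset : Finset _) := by
    ext S
    rw [Finset.mem_coe, Finset.mem_biUnion]
    simp only [Set.Finite.mem_toFinset, Set.mem_range]
    constructor
    · rintro ⟨r, hr, rfl⟩
      obtain ⟨d, hd, h⟩ := exists_closure_eq_frobeniusFixed (p := p) hK r.fst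
      refine ⟨d, hd, Units.mk0 _ hr, ?_⟩
      rw [closure_singleton_eq_dualSubring hn hK, h, Units.val_mk0]
    · rintro ⟨d, hd, c, rfl⟩
      obtain ⟨x, hx⟩ := exists_eq_closure hK hd
      refine ⟨TrivSqZeroExt.inl x + TrivSqZeroExt.inr (c : K), by simp, ?_⟩
      rw [closure_singleton_eq_dualSubring hn hK, ← hx]
      simp
  rw [hset, Set.ncard_coe_finset, Finset.card_biUnion, cliqueB]
  · refine Finset.sum_congr rfl fun d hd => ?_
    rw [← Set.ncard_eq_toFinset_card _ (hfin d), ncard_range_dualSubring hK hd]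
  · intro d hd e he hde
    rw [Function.onFun, Finset.disjoint_left]
    intro S hS hS'
    rw [Set.Finite.mem_toFinset] at hS hS'
    obtain ⟨c, rfl⟩ := hS
    obtain ⟨c', h⟩ := hS'
    apply hde
    apply frobeniusFixed_injOn hK hd he
    have h' : dualSubring (frobeniusFixed K p e) (c' : K) =
      dualSubring (frobeniusFixed K p d) c := h
    rw [← dualSubring_map_fst (frobeniusFixed K p d) (c : K), ← h', dualSubring_map_fst]

end DualNumberSubrings

/-! ### Transport of the counts to centralizers of matrices -/

section ClassCount

open Matrix Polynomial

variable {F : Type*} [Field F]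

theorem ncard_closure_eq_of_injective {R S : Type*} [Ring R] [Ring S] (f : R →+* S)
    (hf : Function.Injective f) {P : R → Prop} {Q : S → Prop}
    (h : ∀ s, Q s ↔ ∃ r, P r ∧ f r = s) :
    {T : Subring S | ∃ s, Q s ∧ T = Subring.closure {s}}.ncard =
      {T : Subring R | ∃ r, P r ∧ T = Subring.closure {r}}.ncard := by
  have hset : {T : Subring S | ∃ s, Q s ∧ T = Subring.closure {s}} =
      Subring.map f '' {T : Subring R | ∃ r, P r ∧ T = Subring.closure {r}} := by
    ext T
    constructor
    · rintro ⟨s, hs, rfl⟩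
      obtain ⟨r, hr, rfl⟩ := (h s).1 hs
      refine ⟨_, ⟨r, hr, rfl⟩, ?_⟩
      rw [RingHom.map_closure, Set.image_singleton]
    · rintro ⟨_, ⟨r, hr, rfl⟩, rfl⟩
      refine ⟨f r, (h _).2 ⟨r, hr, rfl⟩, ?_⟩
      rw [RingHom.map_closure, Set.image_singleton]
  rw [hset, Set.ncard_image_of_injective]
  intro T T' hT
  apply SetLike.coe_injective
  apply hf.image_injective
  rw [← Subring.coe_map, ← Subring.coe_map, hT]

theorem ncard_closure_mem_center [Finite F] {p n : ℕ} [Fact p.Prime] [CharP F p]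
    (hF : Nat.card F = p ^ n) :
    {S : Subring (Matrix (Fin 2) (Fin 2) F) | ∃ B, B ∈ Subring.center (Matrix (Fin 2) (Fin 2) F) ∧
      S = Subring.closure {B}}.ncard = numDiv n := by
  rw [ncard_closure_eq_of_injective (algebraMap F (Matrix (Fin 2) (Fin 2) F))
    (FaithfulSMul.algebraMap_injective _ _) (P := fun _ => True)]
  · simp only [true_and]
    exact ncard_closure_singleton hF
  · intro B
    rw [mem_center_iff_mem_range_algebraMap, RingHom.mem_range]
    simp

/-- The ring homomorphism `F × F → M₂(F)` attached to an idempotent matrix. -/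
def idempotentHom {E : Matrix (Fin 2) (Fin 2) F} (hE : E * E = E) :
    F × F →+* Matrix (Fin 2) (Fin 2) F where
  toFun z := z.2 • 1 + (z.1 - z.2) • E
  map_zero' := by simp
  map_one' := by simp
  map_add' z w := by
    simp only [Prod.fst_add, Prod.snd_add, add_smul, sub_smul]
    abel
  map_mul' z w := by
    simp only [Prod.fst_mul, Prod.snd_mul, sub_smul, mul_add, add_mul, mul_sub, sub_mul,
      smul_mul_smul_comm, hE, one_mul, mul_one]
    abel

theorem ncard_closure_centralizer_of_isDiagType [Finite F] {p n : ℕ} [Fact p.Prime] [CharP F p]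
    (hn : n ≠ 0) (hF : Nat.card F = p ^ n) {A : Matrix (Fin 2) (Fin 2) F} (hA : IsDiagType A) :
    {S : Subring (Matrix (Fin 2) (Fin 2) F) | ∃ B,
      Subring.centralizer {B} = Subring.centralizer {A} ∧
      S = Subring.closure {B}}.ncard = cliqueA p n := by
  obtain ⟨x, y, E, hy, hE, hEc, rfl⟩ := isDiagType_iff.1 hA
  rw [(centralizer_eq_iff_exists hEc).2 ⟨x, y, hy, rfl⟩]
  rw [ncard_closure_eq_of_injective (idempotentHom hE) ?_ (P := fun z => z.1 ≠ z.2)]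
  · exact ncard_closure_pair hn hF
  · intro B
    rw [centralizer_eq_iff_exists hEc]
    constructor
    · rintro ⟨a, b, hb, rfl⟩
      refine ⟨(a + b, a), by simpa using hb, ?_⟩
      simp [idempotentHom]
    · rintro ⟨z, hz, rfl⟩
      exact ⟨z.2, z.1 - z.2, sub_ne_zero.2 hz, rfl⟩
  · rintro ⟨a, b⟩ ⟨c, d⟩ h
    obtain ⟨h1, h2⟩ := smul_one_add_smul_inj hEc h
    have h1 : b = d := h1
    subst h1
    exact Prod.ext (sub_left_injective h2) rfl

/-- The ring homomorphism `F[ε] → M₂(F)` attached to a matrix of square zero. -/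
def nilpotentHom {N : Matrix (Fin 2) (Fin 2) F} (hN : N * N = 0) :
    DualNumber F →+* Matrix (Fin 2) (Fin 2) F where
  toFun z := z.fst • 1 + z.snd • N
  map_zero' := by simp
  map_one' := by simp
  map_add' z w := by
    simp only [TrivSqZeroExt.fst_add, TrivSqZeroExt.snd_add, add_smul]
    abel
  map_mul' z w := by
    simp only [TrivSqZeroExt.fst_mul, DualNumber.snd_mul, add_smul, mul_add, add_mul,
      smul_mul_smul_comm, hN, one_mul, mul_one, smul_zero, add_zero]
    abel

theorem ncard_closure_centralizer_of_isNonsemisimpleType [Finite F] {p n : ℕ} [Fact p.Prime]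
    [CharP F p] (hn : n ≠ 0) (hF : Nat.card F = p ^ n) {A : Matrix (Fin 2) (Fin 2) F}
    (hA : IsNonsemisimpleType A) :
    {S : Subring (Matrix (Fin 2) (Fin 2) F) | ∃ B,
      Subring.centralizer {B} = Subring.centralizer {A} ∧
      S = Subring.closure {B}}.ncard = cliqueB p n := by
  obtain ⟨x, N, hN, hNc, rfl⟩ := isNonsemisimpleType_iff.1 hA
  rw [(centralizer_eq_iff_exists hNc).2 ⟨x, 1, one_ne_zero, by rw [one_smul]⟩]
  rw [ncard_closure_eq_of_injective (nilpotentHom hN) ?_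
    (P := fun r => TrivSqZeroExt.snd r ≠ 0)]
  · exact ncard_closure_snd_ne_zero hn hF
  · intro B
    rw [centralizer_eq_iff_exists hNc]
    constructor
    · rintro ⟨a, b, hb, rfl⟩
      refine ⟨TrivSqZeroExt.inl a + TrivSqZeroExt.inr b, by simpa using hb, ?_⟩
      simp [nilpotentHom]
    · rintro ⟨z, hz, rfl⟩
      exact ⟨z.fst, z.snd, hz, rfl⟩
  · intro z w h
    obtain ⟨h1, h2⟩ := smul_one_add_smul_inj hNc h
    exact TrivSqZeroExt.ext h1 h2

theorem ncard_closure_centralizer_of_isIrredType [Finite F] {p n : ℕ} [Fact p.Prime]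
    [CharP F p] (hn : n ≠ 0) (hF : Nat.card F = p ^ n) {A : Matrix (Fin 2) (Fin 2) F}
    (hA : IsIrredType A) :
    {S : Subring (Matrix (Fin 2) (Fin 2) F) | ∃ B,
      Subring.centralizer {B} = Subring.centralizer {A} ∧
      S = Subring.closure {B}}.ncard = cliqueC n := by
  obtain ⟨hAc, hirr⟩ := hA
  have : Fact (Irreducible (minpoly F A)) := ⟨hirr⟩
  let pb := AdjoinRoot.powerBasis hirr.ne_zero
  have : Module.Finite F (AdjoinRoot (minpoly F A)) := pb.finite
  have : Finite (AdjoinRoot (minpoly F A)) := Module.finite_of_finite F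
  have : CharP (AdjoinRoot (minpoly F A)) p :=
    charP_of_injective_algebraMap (algebraMap F (AdjoinRoot (minpoly F A))).injective p
  have hcard : Nat.card (AdjoinRoot (minpoly F A)) = p ^ (2 * n) := by
    rw [Module.natCard_eq_pow_finrank (K := F), hF, pb.finrank, AdjoinRoot.powerBasis_dim,
      minpoly_natDegree_of_notMem_center hAc, ← pow_mul, mul_comm]
  -- Evaluation at A identifies the centralizer of A with a field of p ^ (2 * n) elements.
  let ψ : AdjoinRoot (minpoly F A) →+* Matrix (Fin 2) (Fin 2) F :=
    Ideal.Quotient.lift (Ideal.span {minpoly F A}) (aeval A : F[X] →ₐ[F] _).toRingHom (by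
      intro f hf
      obtain ⟨g, rfl⟩ := Ideal.mem_span_singleton.1 hf
      simp)
  have hψ : Function.Injective ψ := ψ.injective
  have hof : ∀ x, ψ (AdjoinRoot.of _ x) = x • 1 := by
    intro x
    have : ψ (AdjoinRoot.of _ x) = aeval A (C x) := rfl
    rw [this, aeval_C, Algebra.algebraMap_eq_smul_one]
  have hroot : ψ (AdjoinRoot.root _) = A := by
    have : ψ (AdjoinRoot.root _) = aeval A X := rfl
    rw [this, aeval_X]
  -- The copy of F is fixed by the n-th power of Frobenius and has as many elements as the root
  -- bound allows. The preimages of scalar matrices are therefore exactly this subfield.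
  have hfix : ∀ r, r ∈ frobeniusFixed (AdjoinRoot (minpoly F A)) p n ↔
      ∃ x, AdjoinRoot.of _ x = r := by
    have : Set.range (AdjoinRoot.of (minpoly F A)) =
        (frobeniusFixed (AdjoinRoot (minpoly F A)) p n : Set _) := by
      apply Set.eq_of_subset_of_ncard_le
      · rintro _ ⟨x, rfl⟩
        have := Fintype.ofFinite F
        rw [SetLike.mem_coe, mem_frobeniusFixed, ← map_pow, ← hF, Nat.card_eq_fintype_card,
          FiniteField.pow_card]
      · refine (natCard_frobeniusFixed_le hn).trans ?_
        rw [← Nat.card_coe_set_eq, Nat.card_range_of_injective (RingHom.injective _), hF]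
      · exact Set.toFinite _
    intro r
    rw [← SetLike.mem_coe, ← this, Set.mem_range]
  rw [ncard_closure_eq_of_injective ψ hψ
    (P := fun r => r ∉ frobeniusFixed (AdjoinRoot (minpoly F A)) p n)]
  · exact ncard_closure_singleton_notMem hn hcard
  · intro B
    constructor
    · intro hB
      obtain ⟨x, y, hy, rfl⟩ := (centralizer_eq_iff_exists hAc).1 hB
      have himg : ψ (AdjoinRoot.of _ x + AdjoinRoot.of _ y * AdjoinRoot.root _) =
          x • 1 + y • A := by
        rw [map_add, map_mul, hof, hof, hroot, smul_mul_assoc, one_mul]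
      refine ⟨_, fun h => ?_, himg⟩
      obtain ⟨z, hz⟩ := (hfix _).1 h
      rw [← hz, hof] at himg
      apply hy
      rw [← smul_one_add_smul_mem_center_iff hAc x y, ← himg]
      exact smul_one_mem_center z
    · rintro ⟨r, hr, rfl⟩
      have hc : ψ r ∉ Subring.center (Matrix (Fin 2) (Fin 2) F) := by
        intro h
        obtain ⟨x, hx⟩ := mem_center_iff_exists_smul_one.1 h
        rw [← hof] at hx
        exact hr ((hfix r).2 ⟨x, (hψ hx).symm⟩)
      rw [centralizer_eq_iff_of_notMem_center hc hAc]
      have h := congrArg ψ (mul_comm r (AdjoinRoot.root _))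
      rwa [map_mul, map_mul, hroot] at h

end ClassCount

/-! ### Families of equal cliques and the assembly of the graph -/

theorem exists_equiv_fin_prod_of_ncard_fiber {α β : Type*} [Finite α] (f : α → β) (s : Set α)
    {t k : ℕ} (ht : (f '' s).ncard = t) (hk : ∀ a ∈ s, {b | b ∈ s ∧ f b = f a}.ncard = k) :
    ∃ e : s ≃ Fin t × Fin k, ∀ a b, (e a).1 = (e b).1 ↔ f a = f b := by
  have : Finite (f '' s) := (Set.toFinite s).image f
  let g : s → f '' s := fun a => ⟨f a, a, a.2, rfl⟩
  let e₀ : f '' s ≃ Fin t := Finite.equivFinOfCardEq ht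
  have hcard : ∀ c, Nat.card {a : s // g a = c} = k := by
    rintro ⟨_, a, ha, rfl⟩
    rw [← hk a ha, ← Nat.card_coe_set_eq]
    refine Nat.card_congr ⟨fun b => ⟨b.1, b.1.2, congrArg Subtype.val b.2⟩,
      fun b => ⟨⟨b.1, b.2.1⟩, Subtype.ext b.2.2⟩, fun _ => rfl, fun _ => rfl⟩
  -- The first coordinate numbers the fiber, the second the element within it.
  let e : s ≃ Fin t × Fin k :=
    (Equiv.sigmaFiberEquiv g).symm.trans
      ((Equiv.sigmaCongrRight fun c => Finite.equivFinOfCardEq (hcard c)).trans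
        ((Equiv.sigmaEquivProd _ _).trans (Equiv.prodCongr e₀ (Equiv.refl _))))
  refine ⟨e, fun a b => ?_⟩
  have h : ∀ a, (e a).1 = e₀ (g a) := fun _ => rfl
  rw [h, h, e₀.apply_eq_iff_eq, Subtype.ext_iff]

namespace LoopGraph

/-- A graph with a set `Z` of dominating vertices, all of whose other vertices fall into three
families of cliques, the cliques being the fibers of a map `f`, is a join of the expected shape. -/
theorem exists_iso_join {V β : Type*} (G : LoopGraph V) (f : V → β) (Z A B C : Set V)
    (hcover : ∀ v, v ∈ Z ∨ v ∈ A ∨ v ∈ B ∨ v ∈ C)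
    (hZ : ∀ v ∈ Z, ∀ w, G.Adj v w)
    (hadj : ∀ v ∉ Z, ∀ w ∉ Z, (G.Adj v w ↔ f v = f w))
    (hA : ∀ v ∈ A, v ∉ Z) (hB : ∀ v ∈ B, v ∉ Z) (hC : ∀ v ∈ C, v ∉ Z)
    (hAB : ∀ v ∈ A, ∀ w ∈ B, f v ≠ f w) (hAC : ∀ v ∈ A, ∀ w ∈ C, f v ≠ f w)
    (hBC : ∀ v ∈ B, ∀ w ∈ C, f v ≠ f w)
    {z ta a tb b tc c : ℕ} (ez : Z ≃ Fin z)
    (ea : A ≃ Fin ta × Fin a) (hea : ∀ v w, (ea v).1 = (ea w).1 ↔ f v = f w)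
    (eb : B ≃ Fin tb × Fin b) (heb : ∀ v w, (eb v).1 = (eb w).1 ↔ f v = f w)
    (ec : C ≃ Fin tc × Fin c) (hec : ∀ v w, (ec v).1 = (ec w).1 ↔ f v = f w) :
    ∃ φ : Iso G ((completeLoop z).join
        ((((completeLoop a).copies ta).disjUnion ((completeLoop b).copies tb)).disjUnion
          ((completeLoop c).copies tc))),
      ∀ v, (v ∈ Z ↔ ∃ x, φ v = Sum.inl x) ∧
        (v ∈ A ↔ ∃ x, φ v = Sum.inr (Sum.inl (Sum.inl x))) ∧
        (v ∈ B ↔ ∃ x, φ v = Sum.inr (Sum.inl (Sum.inr x))) ∧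
        (v ∈ C ↔ ∃ x, φ v = Sum.inr (Sum.inr x)) := by
  let ψ : Fin z ⊕ ((Fin ta × Fin a ⊕ Fin tb × Fin b) ⊕ Fin tc × Fin c) → V :=
    Sum.elim (fun x => ez.symm x)
      (Sum.elim (Sum.elim (fun x => ea.symm x) fun x => eb.symm x) fun x => ec.symm x)
  have memZ : ∀ x, (ez.symm x : V) ∈ Z := fun x => (ez.symm x).2
  have memA : ∀ x, (ea.symm x : V) ∈ A := fun x => (ea.symm x).2
  have memB : ∀ x, (eb.symm x : V) ∈ B := fun x => (eb.symm x).2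
  have memC : ∀ x, (ec.symm x : V) ∈ C := fun x => (ec.symm x).2
  have hinj : Function.Injective ψ := by
    rintro (x | (x | x) | x) (y | (y | y) | y) h <;>
      simp only [ψ, Sum.elim_inl, Sum.elim_inr] at h
    · rw [ez.symm.injective (Subtype.ext h)]
    · exact (hA _ (memA y) (h ▸ memZ x)).elim
    · exact (hB _ (memB y) (h ▸ memZ x)).elim
    · exact (hC _ (memC y) (h ▸ memZ x)).elim
    · exact (hA _ (memA x) (h ▸ memZ y)).elim
    · rw [ea.symm.injective (Subtype.ext h)]
    · exact (hAB _ (memA x) _ (memB y) (congrArg f h)).elim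
    · exact (hAC _ (memA x) _ (memC y) (congrArg f h)).elim
    · exact (hB _ (memB x) (h ▸ memZ y)).elim
    · exact (hAB _ (memA y) _ (memB x) (congrArg f h.symm)).elim
    · rw [eb.symm.injective (Subtype.ext h)]
    · exact (hBC _ (memB x) _ (memC y) (congrArg f h)).elim
    · exact (hC _ (memC x) (h ▸ memZ y)).elim
    · exact (hAC _ (memA y) _ (memC x) (congrArg f h.symm)).elim
    · exact (hBC _ (memB y) _ (memC x) (congrArg f h.symm)).elim
    · rw [ec.symm.injective (Subtype.ext h)]
  have rangeZ : ∀ v, v ∈ Z ↔ ∃ x, v = ψ (Sum.inl x) := fun v =>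
    ⟨fun hv => ⟨ez ⟨v, hv⟩, by simp [ψ]⟩, by rintro ⟨x, rfl⟩; exact memZ x⟩
  have rangeA : ∀ v, v ∈ A ↔ ∃ x, v = ψ (Sum.inr (Sum.inl (Sum.inl x))) := fun v =>
    ⟨fun hv => ⟨ea ⟨v, hv⟩, by simp [ψ]⟩, by rintro ⟨x, rfl⟩; exact memA x⟩
  have rangeB : ∀ v, v ∈ B ↔ ∃ x, v = ψ (Sum.inr (Sum.inl (Sum.inr x))) := fun v =>
    ⟨fun hv => ⟨eb ⟨v, hv⟩, by simp [ψ]⟩, by rintro ⟨x, rfl⟩; exact memB x⟩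
  have rangeC : ∀ v, v ∈ C ↔ ∃ x, v = ψ (Sum.inr (Sum.inr x)) := fun v =>
    ⟨fun hv => ⟨ec ⟨v, hv⟩, by simp [ψ]⟩, by rintro ⟨x, rfl⟩; exact memC x⟩
  have hsurj : Function.Surjective ψ := by
    intro v
    rcases hcover v with h | h | h | h
    · obtain ⟨x, rfl⟩ := (rangeZ v).1 h
      exact ⟨_, rfl⟩
    · obtain ⟨x, rfl⟩ := (rangeA v).1 h
      exact ⟨_, rfl⟩
    · obtain ⟨x, rfl⟩ := (rangeB v).1 h
      exact ⟨_, rfl⟩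
    · obtain ⟨x, rfl⟩ := (rangeC v).1 h
      exact ⟨_, rfl⟩
  let e := Equiv.ofBijective ψ ⟨hinj, hsurj⟩
  let H := (completeLoop z).join
        ((((completeLoop a).copies ta).disjUnion ((completeLoop b).copies tb)).disjUnion
          ((completeLoop c).copies tc))
  have hmap : ∀ x y, G.Adj (ψ x) (ψ y) ↔ H.Adj x y := by
    have hZ' : ∀ v ∈ Z, ∀ w, G.Adj w v := fun v hv w => G.symm _ _ (hZ v hv w)
    rintro (x | (x | x) | x) (y | (y | y) | y)
    · exact iff_of_true (hZ _ (memZ x) _) trivial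
    · exact iff_of_true (hZ _ (memZ x) _) trivial
    · exact iff_of_true (hZ _ (memZ x) _) trivial
    · exact iff_of_true (hZ _ (memZ x) _) trivial
    · exact iff_of_true (hZ' _ (memZ y) _) trivial
    · refine (hadj _ (hA _ (memA x)) _ (hA _ (memA y))).trans ((hea _ _).symm.trans ?_)
      rw [ea.apply_symm_apply, ea.apply_symm_apply]
      exact (and_iff_left trivial).symm
    · exact iff_of_false (fun h => hAB _ (memA x) _ (memB y)
        ((hadj _ (hA _ (memA x)) _ (hB _ (memB y))).1 h)) id
    · exact iff_of_false (fun h => hAC _ (memA x) _ (memC y)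
        ((hadj _ (hA _ (memA x)) _ (hC _ (memC y))).1 h)) id
    · exact iff_of_true (hZ' _ (memZ y) _) trivial
    · exact iff_of_false (fun h => hAB _ (memA y) _ (memB x)
        ((hadj _ (hB _ (memB x)) _ (hA _ (memA y))).1 h).symm) id
    · refine (hadj _ (hB _ (memB x)) _ (hB _ (memB y))).trans ((heb _ _).symm.trans ?_)
      rw [eb.apply_symm_apply, eb.apply_symm_apply]
      exact (and_iff_left trivial).symm
    · exact iff_of_false (fun h => hBC _ (memB x) _ (memC y)
        ((hadj _ (hB _ (memB x)) _ (hC _ (memC y))).1 h)) id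
    · exact iff_of_true (hZ' _ (memZ y) _) trivial
    · exact iff_of_false (fun h => hAC _ (memA y) _ (memC x)
        ((hadj _ (hC _ (memC x)) _ (hA _ (memA y))).1 h).symm) id
    · exact iff_of_false (fun h => hBC _ (memB y) _ (memC x)
        ((hadj _ (hC _ (memC x)) _ (hB _ (memB y))).1 h).symm) id
    · refine (hadj _ (hC _ (memC x)) _ (hC _ (memC y))).trans ((hec _ _).symm.trans ?_)
      rw [ec.apply_symm_apply, ec.apply_symm_apply]
      exact (and_iff_left trivial).symm
  let φ : Iso G H := RelIso.symm ⟨e, fun {x y} => hmap x y⟩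
  have hφ : ∀ v x, φ v = x ↔ v = ψ x := fun v x => e.symm_apply_eq
  refine ⟨φ, fun v => ?_⟩
  simp only [hφ]
  exact ⟨rangeZ v, rangeA v, rangeB v, rangeC v⟩

end LoopGraph

/-! ### Matrix types and centralizers on the level of classes -/

section Classes

variable {R : Type*} [Ring R]

/-- The subring generated by a class. -/
def UnitalClass.closure : UnitalClass R → Subring R :=
  Quotient.lift (fun a => Subring.closure {a}) fun _ _ h => h

theorem UnitalClass.closure_injective :
    Function.Injective (UnitalClass.closure : UnitalClass R → Subring R) := by
  rintro ⟨a⟩ ⟨b⟩ h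
  exact Quotient.sound h

/-- The centralizer of a class. -/
def UnitalClass.centralizer : UnitalClass R → Subring R :=
  Quotient.lift (fun a => Subring.centralizer {a}) fun a b h => by
    ext x
    simp only [Subring.mem_centralizer_iff, Set.mem_singleton_iff, forall_eq]
    exact ⟨commute_of_closure_eq h rfl, commute_of_closure_eq h.symm rfl⟩

theorem UnitalClass.exists_rep (v : UnitalClass R) : ∃ a, unitalClass a = v :=
  Quotient.exists_rep v

variable (P : R → Prop)

/-- The classes of the elements with the property `P`. -/
def classesOf : Set (UnitalClass R) := {v | ∃ a, P a ∧ unitalClass a = v}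

variable {P}

/-- Elements that generate the same subring have the same centralizer, so a property determined by
the centralizer descends to classes. -/
theorem unitalClass_mem_classesOf_iff
    (hP : ∀ a b : R, Subring.centralizer {b} = Subring.centralizer {a} → P a → P b) {a : R} :
    unitalClass a ∈ classesOf P ↔ P a := by
  constructor
  · rintro ⟨b, hb, h⟩
    exact hP b a (congrArg UnitalClass.centralizer h).symm hb
  · intro ha
    exact ⟨a, ha, rfl⟩

theorem closure_image_classesOf :
    UnitalClass.closure '' classesOf P = {S | ∃ a, P a ∧ S = Subring.closure {a}} := by
  ext S
  constructor
  · rintro ⟨_, ⟨a, ha, rfl⟩, rfl⟩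
    exact ⟨a, ha, rfl⟩
  · rintro ⟨a, ha, rfl⟩
    exact ⟨_, ⟨a, ha, rfl⟩, rfl⟩

theorem ncard_classesOf :
    (classesOf P).ncard = {S | ∃ a, P a ∧ S = Subring.closure {a}}.ncard := by
  rw [← closure_image_classesOf, Set.ncard_image_of_injective _ UnitalClass.closure_injective]

/-- The size of a clique becomes the number of subrings with a generator of the given centralizer,
the form computed for each matrix type. -/
theorem ncard_classesOf_centralizer_eq
    (hP : ∀ a b : R, Subring.centralizer {b} = Subring.centralizer {a} → P a → P b) {a : R}
    (ha : P a) :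
    {v | v ∈ classesOf P ∧ v.centralizer = (unitalClass a).centralizer}.ncard =
      {S | ∃ b, Subring.centralizer {b} = Subring.centralizer {a} ∧
        S = Subring.closure {b}}.ncard := by
  rw [← ncard_classesOf]
  congr 1
  ext v
  constructor
  · rintro ⟨⟨b, hb, rfl⟩, h⟩
    exact ⟨b, h, rfl⟩
  · rintro ⟨b, hb, rfl⟩
    exact ⟨⟨b, hP a b hb ha, rfl⟩, hb⟩

theorem exists_equiv_classesOf [Finite R] {t k : ℕ}
    (hP : ∀ a b : R, Subring.centralizer {b} = Subring.centralizer {a} → P a → P b)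
    (ht : {S | ∃ a, P a ∧ S = Subring.centralizer {a}}.ncard = t)
    (hk : ∀ a, P a → {S | ∃ b, Subring.centralizer {b} = Subring.centralizer {a} ∧
        S = Subring.closure {b}}.ncard = k) :
    ∃ e : classesOf P ≃ Fin t × Fin k, ∀ v w, (e v).1 = (e w).1 ↔
      UnitalClass.centralizer v.1 = UnitalClass.centralizer w.1 := by
  have : Finite (UnitalClass R) := Quotient.finite _
  apply exists_equiv_fin_prod_of_ncard_fiber
  · rw [← ht]
    congr 1
    ext S
    constructor
    · rintro ⟨_, ⟨a, ha, rfl⟩, rfl⟩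
      exact ⟨a, ha, rfl⟩
    · rintro ⟨a, ha, rfl⟩
      exact ⟨_, ⟨a, ha, rfl⟩, rfl⟩
  · rintro _ ⟨a, ha, rfl⟩
    rw [ncard_classesOf_centralizer_eq hP ha, hk a ha]

end Classes

theorem charP_of_natCard_eq_prime_pow {F : Type*} [Field F] [Finite F] {p n : ℕ} (hp : p.Prime)
    (hF : Nat.card F = p ^ n) : CharP F p := by
  have := Fintype.ofFinite F
  obtain ⟨q, hq, m, hqp, hm⟩ := FiniteField.card' F
  rw [← Nat.card_eq_fintype_card, hF] at hm
  have h : q ∣ p ^ n := hm ▸ dvd_pow_self q m.ne_zero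
  rwa [← (Nat.prime_dvd_prime_iff_eq hqp hp).1 (hqp.dvd_of_dvd_pow h)]

theorem theorem4p1 {F : Type*} [Field F] (p n : ℕ) (hp : p.Prime) (hn : 1 ≤ n)
    (hF : Nat.card F = p ^ n) :
    (∃ φ : LoopGraph.Iso (unitalCCG (Matrix (Fin 2) (Fin 2) F)) (modelGraph p n),
      ∀ A : Matrix (Fin 2) (Fin 2) F,
        (A ∈ Subring.center (Matrix (Fin 2) (Fin 2) F) ↔
          ∃ v, φ (unitalClass A) = Sum.inl v) ∧
        (IsDiagType A ↔ ∃ v, φ (unitalClass A) = Sum.inr (Sum.inl (Sum.inl v))) ∧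
        (IsNonsemisimpleType A ↔ ∃ v, φ (unitalClass A) = Sum.inr (Sum.inl (Sum.inr v))) ∧
        (IsIrredType A ↔ ∃ v, φ (unitalClass A) = Sum.inr (Sum.inr v))) ∧
    (∀ A B : Matrix (Fin 2) (Fin 2) F,
      A ∉ Subring.center (Matrix (Fin 2) (Fin 2) F) →
      B ∉ Subring.center (Matrix (Fin 2) (Fin 2) F) →
      ((unitalCCG (Matrix (Fin 2) (Fin 2) F)).Adj (unitalClass A) (unitalClass B) ↔
        Subring.centralizer {A} = Subring.centralizer {B})) ∧
    (centralizersOf (F := F) IsDiagType).ncard = countA p n ∧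
    (centralizersOf (F := F) IsNonsemisimpleType).ncard = countB p n ∧
    (centralizersOf (F := F) IsIrredType).ncard = countC p n := by
  have hn0 : n ≠ 0 := by lia
  have : Finite F := Nat.finite_of_card_ne_zero (hF ▸ pow_ne_zero n hp.ne_zero)
  have : Fact p.Prime := ⟨hp⟩
  have : CharP F p := charP_of_natCard_eq_prime_pow hp hF
  have hcountA : (centralizersOf (F := F) IsDiagType).ncard = countA p n := by
    have h := ncard_centralizersOf_isDiagType (F := F)
    rw [hF] at h
    rw [countA, mul_comm 2 n, pow_mul]
    apply Nat.eq_div_of_mul_eq_left two_ne_zero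
    rw [h]
    ring
  have hcountB : (centralizersOf (F := F) IsNonsemisimpleType).ncard = countB p n := by
    rw [ncard_centralizersOf_isNonsemisimpleType, hF, countB]
  have hcountC : (centralizersOf (F := F) IsIrredType).ncard = countC p n := by
    have h := ncard_centralizersOf_isIrredType (F := F)
    rw [hF] at h
    rw [countC, mul_comm 2 n, pow_mul]
    apply Nat.eq_div_of_mul_eq_left two_ne_zero
    lia
  have hadj : ∀ A B : Matrix (Fin 2) (Fin 2) F,
      A ∉ Subring.center (Matrix (Fin 2) (Fin 2) F) →
      B ∉ Subring.center (Matrix (Fin 2) (Fin 2) F) →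
      ((unitalCCG (Matrix (Fin 2) (Fin 2) F)).Adj (unitalClass A) (unitalClass B) ↔
        Subring.centralizer {A} = Subring.centralizer {B}) := fun A B hA hB =>
    (centralizer_eq_iff_of_notMem_center hA hB).symm
  refine ⟨?_, hadj, hcountA, hcountB, hcountC⟩
  have : Finite (Matrix (Fin 2) (Fin 2) F) := inferInstanceAs (Finite (Fin 2 → Fin 2 → F))
  have : Finite (UnitalClass (Matrix (Fin 2) (Fin 2) F)) := Quotient.finite _
  have invZ : ∀ A B : Matrix (Fin 2) (Fin 2) F,
      Subring.centralizer {B} = Subring.centralizer {A} →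
      A ∈ Subring.center (Matrix (Fin 2) (Fin 2) F) →
      B ∈ Subring.center (Matrix (Fin 2) (Fin 2) F) := by
    intro A B h hA
    rwa [← centralizer_eq_top_iff, h, centralizer_eq_top_iff]
  have invA := fun A B : Matrix (Fin 2) (Fin 2) F => isDiagType_of_centralizer_eq (A := A) (B := B)
  have invB := fun A B : Matrix (Fin 2) (Fin 2) F =>
    isNonsemisimpleType_of_centralizer_eq (A := A) (B := B)
  have invC := fun A B : Matrix (Fin 2) (Fin 2) F => isIrredType_of_centralizer_eq (A := A) (B := B)
  obtain ⟨ea, hea⟩ := exists_equiv_classesOf invA hcountA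
    fun A hA => ncard_closure_centralizer_of_isDiagType hn0 hF hA
  obtain ⟨eb, heb⟩ := exists_equiv_classesOf invB hcountB
    fun A hA => ncard_closure_centralizer_of_isNonsemisimpleType hn0 hF hA
  obtain ⟨ec, hec⟩ := exists_equiv_classesOf invC hcountC
    fun A hA => ncard_closure_centralizer_of_isIrredType hn0 hF hA
  let ez : classesOf (fun A => A ∈ Subring.center (Matrix (Fin 2) (Fin 2) F)) ≃ Fin (numDiv n) :=
    Finite.equivFinOfCardEq (ncard_classesOf.trans (ncard_closure_mem_center hF))
  have memZ := fun A => unitalClass_mem_classesOf_iff invZ (a := A)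
  have memA := fun A => unitalClass_mem_classesOf_iff invA (a := A)
  have memB := fun A => unitalClass_mem_classesOf_iff invB (a := A)
  have memC := fun A => unitalClass_mem_classesOf_iff invC (a := A)
  -- The centralizer labels the cliques; different types never share a label because the type is an
  -- invariant of the centralizer.
  obtain ⟨φ, hφ⟩ := LoopGraph.exists_iso_join (unitalCCG (Matrix (Fin 2) (Fin 2) F))
    UnitalClass.centralizer (classesOf fun A => A ∈ Subring.center (Matrix (Fin 2) (Fin 2) F))
    (classesOf IsDiagType) (classesOf IsNonsemisimpleType) (classesOf IsIrredType)
    (by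
      intro v
      obtain ⟨A, rfl⟩ := v.exists_rep
      rw [memZ, memA, memB, memC, isIrredType_iff]
      tauto)
    (by
      rintro _ ⟨A, hA, rfl⟩ w
      obtain ⟨B, rfl⟩ := w.exists_rep
      exact (Subring.mem_center_iff.1 hA B).symm)
    (by
      intro v hv w hw
      obtain ⟨A, rfl⟩ := v.exists_rep
      obtain ⟨B, rfl⟩ := w.exists_rep
      rw [memZ] at hv hw
      exact hadj A B hv hw)
    (by
      rintro _ ⟨A, hA, rfl⟩
      rw [memZ]
      exact hA.notMem_center)
    (by
      rintro _ ⟨A, hA, rfl⟩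
      rw [memZ]
      exact hA.notMem_center)
    (by
      rintro _ ⟨A, hA, rfl⟩
      rw [memZ]
      exact hA.1)
    (by
      rintro _ ⟨A, hA, rfl⟩ _ ⟨B, hB, rfl⟩ h
      exact hA.not_isNonsemisimpleType (invB B A h hB))
    (by
      rintro _ ⟨A, hA, rfl⟩ _ ⟨B, hB, rfl⟩ h
      exact (isIrredType_iff.1 (invC B A h hB)).2.1 hA)
    (by
      rintro _ ⟨A, hA, rfl⟩ _ ⟨B, hB, rfl⟩ h
      exact (isIrredType_iff.1 (invC B A h hB)).2.2 hA)
    ez ea hea eb heb ec hec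
  refine ⟨φ, fun A => ?_⟩
  have h := hφ (unitalClass A)
  rwa [memZ, memA, memB, memC] at h
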